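/- Real random variables $S,T$ are called FKG if $\mathrm{Cov}(F(S,T),G(S,T))\ge 0$ for all measurable, coordinatewise non-decreasing functions $F,G:\mathbb{R}^2\to\mathbb{R}$ with $F(S,T),G(S,T)\in L^2$. For a random variable $U$ with smooth density $f$, let $\rho_U=f'/f$ be its score function and $J(U)=\mathbb{E}\,\rho_U(U)^2$ its Fisher information. For random variables $X,Y$ and $\beta\in[0,1]$ let $$\Delta(X,Y,\beta)=\mathbb{E}\Bigl(\sqrt{\beta}\,\rho_X(X)+\sqrt{1-\beta}\,\rho_Y(Y)-\widetilde\rho\bigl(\sqrt{\beta}X+\sqrt{1-\beta}\,Y\bigr)\Bigr)^2,$$ where $\widetilde\rho$ is the score function of $\sqrt{\beta}X+\sqrt{1-\beta}\,Y$. Let $K\in\mathbb{R}$ and $\tau>0$. Let $S,T$ be FKG random variables with mean zero and (finite) variances at most $K$, let $Z_S,Z_T$ be $N(0,\tau)$ random variables (that is, of variance $\tau$) that are independent of $(S,T)$ and of each other, and put $X=S+Z_S$, $Y=T+Z_T$. Then for every $\beta\in[0,1]$ the variables $X$, $Y$ and $\sqrt\beta X+\sqrt{1-\beta}\,Y$ have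 smooth densities and finite Fisher information, and the following hold. (i) For every $\epsilon>0$ there is a constant $C=C(K,\tau,\epsilon)$ such that for all such $S,T,Z_S,Z_T$ and all $\beta\in[0,1]$ $$\beta J(X)+(1-\beta)J(Y)-J\bigl(\sqrt{\beta}X+\sqrt{1-\beta}\,Y\bigr)+C\,\mathrm{Cov}(S,T)^{1/3-\epsilon}\ \ge\ \Delta(X,Y,\beta).$$ (ii) For every $\epsilon>0$, $\delta>0$ and $L$ there is a constant $C=C(K,\tau,\epsilon,\delta,L)$ such that for all such $S,T,Z_S,Z_T$ which satisfy in addition $\mathbb{E}|S|^{2+\delta}\le L$ and $\mathbb{E}|T|^{2+\delta}\le L$, and all $\beta\in[0,1]$, $$\beta J(X)+(1-\beta)J(Y)-J\bigl(\sqrt{\beta}X+\sqrt{1-\beta}\,Y\bigr)+C\,\mathrm{Cov}(S,T)^{\frac{2+\delta}{6+\delta}-\epsilon}\ \ge\ \Delta(X,Y,\beta).$$ (Here a zero covariance raised to a negative power is read as $0$.) -/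

import Mathlib

open MeasureTheory ProbabilityTheory
open scoped NNReal ENNReal

universe u

noncomputable section

namespace FKGFisher

/-- The random variables `X 0, …, X (m - 1)` are FKG: increasing functions of them have
non-negative covariance, whenever these functions are measurable and square integrable,
so that the covariance exists. -/
def IsFKG {Ω : Type*} [MeasurableSpace Ω] {m : ℕ} (X : Fin m → Ω → ℝ) (μ : Measure Ω) : Prop :=
  ∀ F G : (Fin m → ℝ) → ℝ, Monotone F → Monotone G → Measurable F → Measurable G →
    MemLp (fun ω => F (fun i => X i ω)) 2 μ → MemLp (fun ω => G (fun i => X i ω)) 2 μ →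
      0 ≤ cov[fun ω => F (fun i => X i ω), fun ω => G (fun i => X i ω); μ]

/-- `f` is a smooth density of the random variable `U` with respect to Lebesgue measure. -/
structure IsSmoothDensity {Ω : Type*} [MeasurableSpace Ω] (f : ℝ → ℝ) (U : Ω → ℝ)
    (μ : Measure Ω) : Prop where
  smooth : ContDiff ℝ (⊤ : ℕ∞) f
  nonneg : ∀ u, 0 ≤ f u
  hasLaw : HasLaw U (volume.withDensity fun u => ENNReal.ofReal (f u)) μ

open Classical in
/-- The smooth density of `U` (it is unique if it exists), and `0` if there is none. -/
def density {Ω : Type*} [MeasurableSpace Ω] (U : Ω → ℝ) (μ : Measure Ω) : ℝ → ℝ :=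
  if h : ∃ f, IsSmoothDensity f U μ then h.choose else 0

/-- The score function `ρ = f' / f` of `U`, where `f` is the density of `U`. -/
def score {Ω : Type*} [MeasurableSpace Ω] (U : Ω → ℝ) (μ : Measure Ω) (u : ℝ) : ℝ :=
  deriv (density U μ) u / density U μ u

/-- The Fisher information `J(U) = 𝔼 ρ(U)²`. -/
def fisherInfo {Ω : Type*} [MeasurableSpace Ω] (U : Ω → ℝ) (μ : Measure Ω) : ℝ :=
  ∫ ω, score U μ (U ω) ^ 2 ∂μ

/-- `U` has a smooth density and finite Fisher information. -/
def HasFiniteFisherInfo {Ω : Type*} [MeasurableSpace Ω] (U : Ω → ℝ) (μ : Measure Ω) : Prop :=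
  (∃ f, IsSmoothDensity f U μ) ∧ MemLp (fun ω => score U μ (U ω)) 2 μ

/-- The combination `√β X + √(1 - β) Y`. -/
def mix {Ω : Type*} (X Y : Ω → ℝ) (β : ℝ) (ω : Ω) : ℝ :=
  √β * X ω + √(1 - β) * Y ω

/-- `Δ(X, Y, β) = 𝔼 (√β ρ_X(X) + √(1 - β) ρ_Y(Y) - ρ̃(√β X + √(1 - β) Y))²`, where `ρ̃` is the
score function of `√β X + √(1 - β) Y`. -/
def scoreGap {Ω : Type*} [MeasurableSpace Ω] (X Y : Ω → ℝ) (β : ℝ) (μ : Measure Ω) : ℝ :=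
  ∫ ω, (√β * score X μ (X ω) + √(1 - β) * score Y μ (Y ω)
    - score (mix X Y β) μ (mix X Y β ω)) ^ 2 ∂μ

/-- `S`, `T` are FKG with mean zero and (finite) variance at most `K`, and `ZS`, `ZT` are
`N(0, τ)` variables which are independent of `(S, T)` and of each other. -/
structure IsFKGPairWithNoise {Ω : Type*} [MeasurableSpace Ω] (S T ZS ZT : Ω → ℝ)
    (K : ℝ) (τ : ℝ≥0) (μ : Measure Ω) : Prop where
  fkg : IsFKG ![S, T] μ
  memLp_S : MemLp S 2 μ
  memLp_T : MemLp T 2 μ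
  mean_S : μ[S] = 0
  mean_T : μ[T] = 0
  var_S : Var[S; μ] ≤ K
  var_T : Var[T; μ] ≤ K
  law_ZS : HasLaw ZS (gaussianReal 0 τ) μ
  law_ZT : HasLaw ZT (gaussianReal 0 τ) μ
  indep_noise : IndepFun ZS ZT μ
  indep : IndepFun (fun ω => (S ω, T ω)) (fun ω => (ZS ω, ZT ω)) μ

end FKGFisher

end

/-!
Let `X = S + Z_S`, `Y = T + Z_T`, `W = √β X + √(1 - β) Y`. The score `ρ_X(X)` is the conditional
expectation of `-Z_S / τ` given `X`, so the residual `V_X = ρ_X(X) + Z_S / τ` is orthogonal to the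
functions of `X`; likewise for `Y` and `W`. Expanding the square in `Δ(X, Y, β)` and using this
orthogonality for `W`, and the independence of `Z_S` and `Y`, leaves
`β J(X) + (1 - β) J(Y) - J(W)` and two correlations of the form `𝔼 k(X, Y) V_X` (or with `V_Y`),
where `k` is a combination of scores. They would vanish if `S` and `T` were independent.

On the event `‖(X, Y)‖ ≤ B` such a correlation is the integral over a square of `k(x, y)` times
`𝔼 f_x(S) g_y(T)`, where `f_x` and `g_y` are Lipschitz and `𝔼 f_x(S) = 0`. So the second factor is
a covariance, and comparing `f_x` with the monotone functions `s ↦ A s ± f_x(s)` bounds it by a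
multiple of `Cov(S, T)`; since scores grow at most linearly, the square contributes
`O(B ^ 4 Cov(S, T))`. By Jensen's inequality the `L^p` norms of the scores are at most those of
`Z / τ`, so by the Hölder and Markov inequalities the complement contributes `O(B ^ (-r (1 - ε)))`
if `S` and `T` have moments of order `r`. Optimising over `B` gives the exponent
`r / (4 + r) - ε`.
-/

noncomputable section

namespace FKGFisher

open Filter Set Topology

section GaussianConvolution

open Polynomial

/-- A polynomial times the density of `N(0, τ)`. These functions are bounded and closed under
derivatives, which is all that is needed to differentiate their convolutions. -/
def polyGauss (τ : ℝ≥0) (P : ℝ[X]) (z : ℝ) : ℝ := P.eval z * gaussianPDFReal 0 τ z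

/-- The polynomial that belongs to the derivative of `polyGauss τ P`. -/
def polyGaussDeriv (τ : ℝ≥0) (P : ℝ[X]) : ℝ[X] := derivative P - C (τ : ℝ)⁻¹ * (X * P)

/-- The convolution of `polyGauss τ P` with the measure `ν`. -/
def gaussConv (τ : ℝ≥0) (ν : Measure ℝ) (P : ℝ[X]) (x : ℝ) : ℝ := ∫ u, polyGauss τ P (x - u) ∂ν

variable {τ : ℝ≥0} {P : ℝ[X]} {ν : Measure ℝ}

lemma polyGauss_one (z : ℝ) : polyGauss τ 1 z = gaussianPDFReal 0 τ z := by
  simp [polyGauss]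

lemma polyGauss_polyGaussDeriv_one (z : ℝ) :
    polyGauss τ (polyGaussDeriv τ 1) z = -(gaussianPDFReal 0 τ z * (z / τ)) := by
  simp only [polyGauss, polyGaussDeriv, derivative_one, mul_one, zero_sub, eval_neg, eval_mul,
    eval_C, eval_X]
  ring

lemma hasDerivAt_gaussianPDFReal (τ : ℝ≥0) (z : ℝ) :
    HasDerivAt (gaussianPDFReal 0 τ) (-(τ : ℝ)⁻¹ * z * gaussianPDFReal 0 τ z) z := by
  have hexponent : HasDerivAt (fun x : ℝ => -(x - 0) ^ 2 / (2 * (τ : ℝ))) (-(τ : ℝ)⁻¹ * z) z := by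
    refine ((((hasDerivAt_id z).sub_const 0).pow 2).neg.div_const (2 * (τ : ℝ))).congr_deriv ?_
    simp only [id]
    ring
  rw [gaussianPDFReal_def]
  exact (hexponent.exp.const_mul _).congr_deriv (by ring)

lemma hasDerivAt_polyGauss (z : ℝ) :
    HasDerivAt (polyGauss τ P) (polyGauss τ (polyGaussDeriv τ P) z) z := by
  refine ((P.hasDerivAt z).mul (hasDerivAt_gaussianPDFReal τ z)).congr_deriv ?_
  simp only [polyGauss, polyGaussDeriv, eval_sub, eval_mul, eval_C, eval_X]
  ring

@[fun_prop]
lemma continuous_polyGauss : Continuous (polyGauss τ P) :=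
  continuous_iff_continuousAt.2 fun z => (hasDerivAt_polyGauss z).continuousAt

lemma tendsto_polyGauss_cocompact (τ : ℝ≥0) (P : ℝ[X]) :
    Tendsto (polyGauss τ P) (cocompact ℝ) (𝓝 0) := by
  rcases eq_or_ne τ 0 with rfl | hτ
  · have hzero : polyGauss 0 P = 0 := by
      ext z
      simp [polyGauss]
    exact hzero ▸ tendsto_const_nhds
  induction P using Polynomial.induction_on' with
  | add p q hp hq =>
    have hadd : polyGauss τ (p + q) = fun z => polyGauss τ p z + polyGauss τ q z := by
      ext z
      simp only [polyGauss, eval_add, add_mul]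
    simpa only [hadd, add_zero] using hp.add hq
  | monomial n a =>
    have hτ' : 0 < (2 * (τ : ℝ))⁻¹ := by positivity
    have hdecay := (tendsto_rpow_abs_mul_exp_neg_mul_sq_cocompact hτ' n).const_mul
      (|a| * (√(2 * Real.pi * τ))⁻¹)
    rw [mul_zero] at hdecay
    refine squeeze_zero_norm (fun z => le_of_eq ?_) hdecay
    rw [polyGauss, eval_monomial, gaussianPDFReal, norm_mul, norm_mul, norm_mul, norm_pow,
      Real.norm_eq_abs, Real.norm_eq_abs, Real.norm_of_nonneg (Real.exp_nonneg _),
      Real.norm_of_nonneg (by positivity), Real.rpow_natCast, sub_zero, neg_div, div_eq_inv_mul,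
      neg_mul]
    ring

lemma exists_norm_polyGauss_le (τ : ℝ≥0) (P : ℝ[X]) : ∃ C : ℝ≥0, ∀ z, ‖polyGauss τ P z‖ ≤ C := by
  let f : ZeroAtInftyContinuousMap ℝ ℝ :=
    ⟨⟨polyGauss τ P, continuous_polyGauss⟩, tendsto_polyGauss_cocompact τ P⟩
  exact ⟨‖f.toBCF‖₊, f.toBCF.norm_coe_le_norm⟩

lemma exists_lipschitzWith_polyGauss (τ : ℝ≥0) (P : ℝ[X]) :
    ∃ L : ℝ≥0, LipschitzWith L (polyGauss τ P) := by
  obtain ⟨L, hL⟩ := exists_norm_polyGauss_le τ (polyGaussDeriv τ P)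
  refine ⟨L, lipschitzWith_of_nnnorm_deriv_le
    (fun z => (hasDerivAt_polyGauss z).differentiableAt) fun z => ?_⟩
  rw [(hasDerivAt_polyGauss z).deriv]
  exact hL z

lemma memLp_polyGauss_sub {Ω : Type*} [MeasurableSpace Ω] {μ : Measure Ω} [IsFiniteMeasure μ]
    {U : Ω → ℝ} (hU : AEMeasurable U μ) (x : ℝ) (p : ℝ≥0∞) :
    MemLp (fun ω => polyGauss τ P (x - U ω)) p μ := by
  obtain ⟨C, hC⟩ := exists_norm_polyGauss_le τ P
  have hm : Continuous fun u => polyGauss τ P (x - u) := by fun_prop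
  exact .of_bound (hm.comp_aestronglyMeasurable hU.aestronglyMeasurable) C
    (.of_forall fun _ => hC _)

lemma integrable_polyGauss_sub [IsFiniteMeasure ν] (x : ℝ) :
    Integrable (fun u => polyGauss τ P (x - u)) ν :=
  memLp_one_iff_integrable.1 (memLp_polyGauss_sub aemeasurable_id x 1)

lemma hasDerivAt_gaussConv [IsFiniteMeasure ν] (x : ℝ) :
    HasDerivAt (gaussConv τ ν P) (gaussConv τ ν (polyGaussDeriv τ P) x) x := by
  obtain ⟨C, hC⟩ := exists_norm_polyGauss_le τ (polyGaussDeriv τ P)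
  refine (hasDerivAt_integral_of_dominated_loc_of_deriv_le (F := fun x u => polyGauss τ P (x - u))
    (F' := fun x u => polyGauss τ (polyGaussDeriv τ P) (x - u)) (bound := fun _ => (C : ℝ))
    univ_mem (.of_forall fun y => (integrable_polyGauss_sub y).1) (integrable_polyGauss_sub x)
    (integrable_polyGauss_sub x).1 (.of_forall fun u y _ => hC _) (integrable_const _)
    (.of_forall fun u y _ => ?_)).2
  simpa using (hasDerivAt_polyGauss (y - u)).comp_sub_const y u

lemma contDiff_gaussConv [IsFiniteMeasure ν] : ContDiff ℝ (⊤ : ℕ∞) (gaussConv τ ν P) := by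
  refine contDiff_infty.2 fun n => ?_
  induction n generalizing P with
  | zero =>
    exact contDiff_zero.2 (continuous_iff_continuousAt.2
      fun x => (hasDerivAt_gaussConv x).continuousAt)
  | succ n ih =>
    have hderiv : deriv (gaussConv τ ν P) = gaussConv τ ν (polyGaussDeriv τ P) :=
      funext fun x => (hasDerivAt_gaussConv x).deriv
    push_cast
    exact contDiff_succ_iff_deriv.2 ⟨fun x => (hasDerivAt_gaussConv x).differentiableAt,
      by simp, hderiv ▸ ih⟩

@[fun_prop]
lemma continuous_gaussConv [IsFiniteMeasure ν] : Continuous (gaussConv τ ν P) :=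
  contDiff_gaussConv.continuous

lemma gaussConv_one_pos [NeZero τ] [NeZero ν] [IsFiniteMeasure ν] (x : ℝ) :
    0 < gaussConv τ ν 1 x := by
  have hpos : ∀ u, 0 < polyGauss τ 1 (x - u) := fun u => by
    rw [polyGauss_one]
    exact gaussianPDFReal_pos 0 τ _ (NeZero.ne τ)
  have hsupp : Function.support (fun u => polyGauss τ 1 (x - u)) = univ :=
    eq_univ_of_forall fun u => (hpos u).ne'
  refine (integral_pos_iff_support_of_nonneg (fun u => (hpos u).le)
    (integrable_polyGauss_sub x)).2 ?_
  simpa [hsupp, pos_iff_ne_zero] using NeZero.ne ν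

/-- The score function of the sum of an `N(0, τ)` variable and an independent one of law `ν`. -/
def gaussScore (τ : ℝ≥0) (ν : Measure ℝ) (x : ℝ) : ℝ :=
  gaussConv τ ν (polyGaussDeriv τ 1) x / gaussConv τ ν 1 x

lemma measurable_gaussScore [IsFiniteMeasure ν] : Measurable (gaussScore τ ν) :=
  continuous_gaussConv.measurable.div continuous_gaussConv.measurable

lemma integral_gaussScore_add [NeZero τ] [NeZero ν] [IsFiniteMeasure ν] (x : ℝ) :
    ∫ u, gaussianPDFReal 0 τ (x - u) * (gaussScore τ ν x + (x - u) / τ) ∂ν = 0 := by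
  have hsplit : ∀ u, gaussianPDFReal 0 τ (x - u) * (gaussScore τ ν x + (x - u) / τ) =
      gaussScore τ ν x * polyGauss τ 1 (x - u) - polyGauss τ (polyGaussDeriv τ 1) (x - u) :=
    fun u => by rw [polyGauss_one, polyGauss_polyGaussDeriv_one]; ring
  simp_rw [hsplit]
  rw [integral_sub ((integrable_polyGauss_sub x).const_mul _) (integrable_polyGauss_sub x),
    integral_const_mul]
  change gaussScore τ ν x * gaussConv τ ν 1 x - gaussConv τ ν _ x = 0
  rw [gaussScore, div_mul_cancel₀ _ (gaussConv_one_pos x).ne', sub_self]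

end GaussianConvolution

section GaussScoreBound

variable {τ : ℝ≥0} {ν : Measure ℝ} [IsProbabilityMeasure ν]

lemma gaussConv_one_eq (τ : ℝ≥0) (ν : Measure ℝ) (x : ℝ) :
    gaussConv τ ν 1 x = ∫ u, gaussianPDFReal 0 τ (x - u) ∂ν := by
  simp only [gaussConv, polyGauss_one]

lemma integrable_gaussianPDFReal_sub_mul_pow (n : ℕ) (x : ℝ) :
    Integrable (fun u => gaussianPDFReal 0 τ (x - u) * (x - u) ^ n) ν := by
  simpa [polyGauss, mul_comm] using integrable_polyGauss_sub (P := Polynomial.X ^ n) (ν := ν) x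

lemma integrable_gaussianPDFReal_sub (x : ℝ) :
    Integrable (fun u => gaussianPDFReal 0 τ (x - u)) ν := by
  simpa using integrable_gaussianPDFReal_sub_mul_pow (τ := τ) (ν := ν) 0 x

lemma sq_gaussScore_mul_gaussConv_le [NeZero τ] (x : ℝ) :
    gaussScore τ ν x ^ 2 * gaussConv τ ν 1 x ≤
      (∫ u, gaussianPDFReal 0 τ (x - u) * (x - u) ^ 2 ∂ν) / τ ^ 2 := by
  set ρ := gaussScore τ ν x with hρ
  have hpt : ∀ u, ρ ^ 2 * gaussianPDFReal 0 τ (x - u) ≤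
      gaussianPDFReal 0 τ (x - u) * (x - u) ^ 2 / τ ^ 2 +
        2 * ρ * (gaussianPDFReal 0 τ (x - u) * (ρ + (x - u) / τ)) := fun u => by
    have := mul_nonneg (gaussianPDFReal_nonneg 0 τ (x - u)) (sq_nonneg (ρ + (x - u) / τ))
    linear_combination this
  have hsq := (integrable_gaussianPDFReal_sub_mul_pow (τ := τ) (ν := ν) 2 x).div_const ((τ : ℝ) ^ 2)
  have hlin : Integrable (fun u => gaussianPDFReal 0 τ (x - u) * (ρ + (x - u) / τ)) ν := by
    have := (integrable_gaussianPDFReal_sub_mul_pow (τ := τ) (ν := ν) 1 x).div_const (τ : ℝ)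
    simp_rw [pow_one, mul_div_assoc] at this
    simp_rw [mul_add]
    exact ((integrable_gaussianPDFReal_sub x).mul_const ρ).add this
  have hint := integral_mono ((integrable_gaussianPDFReal_sub x).const_mul (ρ ^ 2))
    (hsq.add (hlin.const_mul (2 * ρ))) hpt
  rwa [integral_add' hsq (hlin.const_mul _), integral_const_mul, integral_const_mul, hρ,
    integral_gaussScore_add, mul_zero, add_zero, integral_div, ← gaussConv_one_eq] at hint

/-- `z ↦ z ^ 2` and the density of `N(0, τ)` are oppositely ordered, so this is an instance of
Chebyshev's integral inequality. -/
lemma integral_gaussianPDFReal_sub_mul_sq_le (hν : MemLp id 2 ν) (x : ℝ) :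
    ∫ u, gaussianPDFReal 0 τ (x - u) * (x - u) ^ 2 ∂ν ≤
      (∫ u, (x - u) ^ 2 ∂ν) * gaussConv τ ν 1 x := by
  set c := ∫ u, (x - u) ^ 2 ∂ν with hc
  have hc0 : √c ^ 2 = c := Real.sq_sqrt (integral_nonneg fun u => sq_nonneg _)
  have hsq : Integrable (fun u => (x - u) ^ 2) ν := ((memLp_const x).sub hν).integrable_sq
  have hpt : ∀ u, gaussianPDFReal 0 τ (x - u) * (x - u) ^ 2 ≤
      c * gaussianPDFReal 0 τ (x - u) + gaussianPDFReal 0 τ √c * ((x - u) ^ 2 - c) := fun u => by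
    have hopposite : ((x - u) ^ 2 - c) * (gaussianPDFReal 0 τ (x - u) - gaussianPDFReal 0 τ √c)
        ≤ 0 := by
      simp only [gaussianPDFReal, sub_zero, hc0]
      rcases le_total c ((x - u) ^ 2) with hle | hle
      · refine mul_nonpos_of_nonneg_of_nonpos (sub_nonneg.2 hle) (sub_nonpos.2 ?_)
        gcongr
      · refine mul_nonpos_of_nonpos_of_nonneg (sub_nonpos.2 hle) (sub_nonneg.2 ?_)
        gcongr
    linear_combination hopposite
  have hphi := (integrable_gaussianPDFReal_sub (τ := τ) (ν := ν) x).const_mul c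
  have hcentred : Integrable (fun u => (x - u) ^ 2 - c) ν := hsq.sub (integrable_const c)
  refine (integral_mono (integrable_gaussianPDFReal_sub_mul_pow 2 x)
    (hphi.add (hcentred.const_mul _)) hpt).trans_eq ?_
  rw [integral_add' hphi (hcentred.const_mul _), integral_const_mul, integral_const_mul,
    integral_sub hsq (integrable_const c), ← hc, ← gaussConv_one_eq, integral_const, probReal_univ,
    one_smul, sub_self, mul_zero, add_zero]

lemma integral_sub_sq_le (hν : MemLp id 2 ν) (x : ℝ) :
    ∫ u, (x - u) ^ 2 ∂ν ≤ (|x| + √(∫ u, u ^ 2 ∂ν)) ^ 2 := by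
  have hmean : (∫ u, u ∂ν) ^ 2 ≤ ∫ u, u ^ 2 ∂ν := by
    have := variance_nonneg id ν
    rw [variance_eq_sub hν] at this
    simpa using this
  have hid : Integrable (fun u : ℝ => u) ν := hν.integrable one_le_two
  have hexp : ∫ u, (x - u) ^ 2 ∂ν = x ^ 2 - 2 * x * ∫ u, u ∂ν + ∫ u, u ^ 2 ∂ν := by
    have hsq : Integrable (fun u : ℝ => u ^ 2) ν := hν.integrable_sq
    have hlin : Integrable (fun u => x ^ 2 - 2 * x * u) ν :=
      (integrable_const _).sub (hid.const_mul _)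
    simp_rw [sub_sq]
    rw [integral_add hlin hsq, integral_sub (integrable_const _) (hid.const_mul _),
      integral_const_mul, integral_const, probReal_univ, one_smul]
  have hcross : -(x * ∫ u, u ∂ν) ≤ |x| * √(∫ u, u ^ 2 ∂ν) :=
    (neg_le_abs _).trans (abs_mul x _ ▸ by gcongr; exact Real.abs_le_sqrt hmean)
  rw [hexp, add_sq, sq_abs, Real.sq_sqrt (integral_nonneg fun u => sq_nonneg u)]
  linarith

lemma abs_gaussScore_le [NeZero τ] (hν : MemLp id 2 ν) (x : ℝ) :
    |gaussScore τ ν x| ≤ (|x| + √(∫ u, u ^ 2 ∂ν)) / τ := by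
  have hmul : gaussScore τ ν x ^ 2 * gaussConv τ ν 1 x ≤
      (∫ u, (x - u) ^ 2 ∂ν) / τ ^ 2 * gaussConv τ ν 1 x := by
    rw [div_mul_eq_mul_div]
    exact (sq_gaussScore_mul_gaussConv_le x).trans
      (div_le_div_of_nonneg_right (integral_gaussianPDFReal_sub_mul_sq_le hν x) (sq_nonneg _))
  refine abs_le_of_sq_le_sq ((le_of_mul_le_mul_right hmul (gaussConv_one_pos x)).trans ?_)
    (by positivity)
  rw [div_pow]
  exact div_le_div_of_nonneg_right (integral_sub_sq_le hν x) (sq_nonneg _)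

end GaussScoreBound

section AddNoise

variable {G : Type*} [MeasurableSpace G] [AddCommGroup G] [MeasurableAdd₂ G] [MeasurableSub₂ G]
  {Ω : Type*} [MeasurableSpace Ω] {μ : Measure Ω} [IsFiniteMeasure μ] {U Z : Ω → G}
  {m : Measure G} [SFinite m] [m.IsAddLeftInvariant] {Φ : G → ℝ≥0∞}

lemma map_add_prod_withDensity (hΦ : Measurable Φ) (ν : Measure G) [SFinite ν] :
    (ν.prod (m.withDensity Φ)).map (fun p => (p.1 + p.2, p.1)) =
      (m.prod ν).withDensity fun q => Φ (q.1 - q.2) := by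
  refine Measure.ext_of_lintegral _ fun H hH => ?_
  rw [lintegral_map hH (by fun_prop), lintegral_prod _ (by fun_prop),
    lintegral_withDensity_eq_lintegral_mul _ (by fun_prop) hH,
    lintegral_prod_symm' _ (by fun_prop)]
  refine lintegral_congr fun u => ?_
  rw [lintegral_withDensity_eq_lintegral_mul _ hΦ (by fun_prop),
    ← lintegral_add_left_eq_self (fun x => ((fun q : G × G => Φ (q.1 - q.2)) * H) (x, u)) u]
  simp only [Pi.mul_apply, add_sub_cancel_left]

lemma hasLaw_add_noise (hΦ : Measurable Φ) (hU : AEMeasurable U μ)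
    (hZ : HasLaw Z (m.withDensity Φ) μ) (hI : IndepFun U Z μ) :
    HasLaw (fun ω => (U ω + Z ω, U ω)) ((m.prod (μ.map U)).withDensity fun q => Φ (q.1 - q.2)) μ :=
  HasLaw.fun_comp ⟨by fun_prop, map_add_prod_withDensity hΦ _⟩ (hI.hasLaw_prod ⟨hU, rfl⟩ hZ)

lemma hasLaw_add (hΦ : Measurable Φ) (hU : AEMeasurable U μ)
    (hZ : HasLaw Z (m.withDensity Φ) μ) (hI : IndepFun U Z μ) :
    HasLaw (U + Z) (m.withDensity fun x => ∫⁻ u, Φ (x - u) ∂μ.map U) μ := by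
  refine HasLaw.fun_comp (Y := Prod.fst) ⟨by fun_prop, ?_⟩ (hasLaw_add_noise hΦ hU hZ hI)
  refine Measure.ext_of_lintegral _ fun H hH => ?_
  rw [lintegral_map hH measurable_fst,
    lintegral_withDensity_eq_lintegral_mul _ (by fun_prop) (by fun_prop),
    lintegral_prod _ (by fun_prop), lintegral_withDensity_eq_lintegral_mul _ (by fun_prop) hH]
  refine lintegral_congr fun x => ?_
  simp only [Pi.mul_apply]
  exact lintegral_mul_const _ (by fun_prop)

lemma integral_add_noise (hΦ : Measurable Φ) (hΦ_top : ∀ x, Φ x < ∞) (hU : AEMeasurable U μ)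
    (hZ : HasLaw Z (m.withDensity Φ) μ) (hI : IndepFun U Z μ) {H : G × G → ℝ} (hH : Measurable H)
    (hint : Integrable (fun ω => H (U ω + Z ω, U ω)) μ) :
    ∫ ω, H (U ω + Z ω, U ω) ∂μ = ∫ x, ∫ u, (Φ (x - u)).toReal * H (x, u) ∂(μ.map U) ∂m := by
  have hlaw := hasLaw_add_noise hΦ hU hZ hI
  have hint' : Integrable H (μ.map fun ω => (U ω + Z ω, U ω)) :=
    (integrable_map_measure hH.aestronglyMeasurable hlaw.aemeasurable).2 hint
  rw [hlaw.map_eq, integrable_withDensity_iff_integrable_smul' (by fun_prop)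
    (.of_forall fun q => hΦ_top _)] at hint'
  simp only [smul_eq_mul] at hint'
  rw [← integral_prod _ hint']
  exact (hlaw.integral_comp hH.aestronglyMeasurable).trans
    (integral_withDensity_eq_integral_toReal_smul (by fun_prop) (.of_forall fun q => hΦ_top _) H)

end AddNoise

lemma IsSmoothDensity.density_eq {Ω : Type*} [MeasurableSpace Ω] {μ : Measure Ω}
    [SFinite μ] {f : ℝ → ℝ} {U : Ω → ℝ} (h : IsSmoothDensity f U μ) :
    density U μ = f := by
  have hex : ∃ f, IsSmoothDensity f U μ := ⟨f, h⟩
  rw [density, dif_pos hex]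
  have h' := hex.choose_spec
  set g := hex.choose
  have hg : Continuous g := h'.smooth.continuous
  have hf : Continuous f := h.smooth.continuous
  have hae := h'.hasLaw.map_eq.symm.trans h.hasLaw.map_eq
  rw [withDensity_eq_iff_of_sigmaFinite (by fun_prop) (by fun_prop)] at hae
  exact (Continuous.ae_eq_iff_eq volume hg hf).1
    (hae.mono fun x hx => (ENNReal.ofReal_eq_ofReal_iff (h'.nonneg x) (h.nonneg x)).1 hx)

/-- `U` is square integrable and `Z` is an independent `N(0, τ)` variable, so that `U + Z` is a
Gaussian regularisation of `U`. -/
structure IsNoisy {Ω : Type*} [MeasurableSpace Ω] (U Z : Ω → ℝ) (τ : ℝ≥0) (μ : Measure Ω) :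
    Prop where
  memLp : MemLp U 2 μ
  law : HasLaw Z (gaussianReal 0 τ) μ
  indep : IndepFun U Z μ

/-- The residual `ρ(U + Z) + Z / τ`, where `ρ` is the score function of `U + Z`: the score is the
conditional expectation of `-Z / τ` given `U + Z`, and this is the error. -/
def scoreResidual {Ω : Type*} [MeasurableSpace Ω] (U Z : Ω → ℝ) (τ : ℝ≥0) (μ : Measure Ω)
    (ω : Ω) : ℝ :=
  score (U + Z) μ (U ω + Z ω) + Z ω / τ

namespace IsNoisy

variable {Ω : Type*} [MeasurableSpace Ω] {μ : Measure Ω} {U Z : Ω → ℝ} {τ : ℝ≥0}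

lemma memLp_noise (h : IsNoisy U Z τ μ) {p : ℝ≥0∞} (hp : p ≠ ∞) : MemLp Z p μ :=
  (memLp_map_measure_iff (g := id) (by fun_prop) h.law.aemeasurable).1
    (h.law.map_eq ▸ memLp_id_gaussianReal' p hp)

lemma memLp_add (h : IsNoisy U Z τ μ) : MemLp (U + Z) 2 μ :=
  h.memLp.add (h.memLp_noise ENNReal.ofNat_ne_top)

lemma law_withDensity [NeZero τ] (h : IsNoisy U Z τ μ) :
    HasLaw Z (volume.withDensity (gaussianPDF 0 τ)) μ :=
  gaussianReal_of_var_ne_zero 0 (NeZero.ne τ) ▸ h.law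

variable [IsProbabilityMeasure μ]

lemma isProbabilityMeasure_map (h : IsNoisy U Z τ μ) : IsProbabilityMeasure (μ.map U) :=
  Measure.isProbabilityMeasure_map h.memLp.aemeasurable

variable [NeZero τ]

lemma isSmoothDensity (h : IsNoisy U Z τ μ) :
    IsSmoothDensity (gaussConv τ (μ.map U) 1) (U + Z) μ where
  smooth := have := h.isProbabilityMeasure_map; contDiff_gaussConv
  nonneg x := have := h.isProbabilityMeasure_map; (gaussConv_one_pos x).le
  hasLaw := by
    have := h.isProbabilityMeasure_map
    have hdensity : ∀ x, ENNReal.ofReal (gaussConv τ (μ.map U) 1 x) =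
        ∫⁻ u, gaussianPDF 0 τ (x - u) ∂μ.map U := fun x => by
      rw [gaussConv_one_eq, ofReal_integral_eq_lintegral_ofReal
        (integrable_gaussianPDFReal_sub x) (.of_forall fun u => gaussianPDFReal_nonneg _ _ _)]
      rfl
    simp_rw [hdensity]
    exact hasLaw_add (measurable_gaussianPDF 0 τ) h.memLp.aemeasurable h.law_withDensity h.indep

lemma score_eq (h : IsNoisy U Z τ μ) : score (U + Z) μ = gaussScore τ (μ.map U) := by
  have := h.isProbabilityMeasure_map
  ext x
  rw [score, h.isSmoothDensity.density_eq, (hasDerivAt_gaussConv x).deriv, gaussScore]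

lemma measurable_score (h : IsNoisy U Z τ μ) : Measurable (score (U + Z) μ) := by
  have := h.isProbabilityMeasure_map
  exact h.score_eq ▸ measurable_gaussScore

lemma abs_score_le (h : IsNoisy U Z τ μ) (x : ℝ) :
    |score (U + Z) μ x| ≤ (|x| + √(∫ ω, U ω ^ 2 ∂μ)) / τ := by
  have := h.isProbabilityMeasure_map
  have hid : MemLp id 2 (μ.map U) := (memLp_map_measure_iff (by fun_prop) h.memLp.aemeasurable).2
    h.memLp
  rw [h.score_eq, ← integral_map h.memLp.aemeasurable (f := fun u => u ^ 2) (by fun_prop)]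
  exact abs_gaussScore_le hid x

lemma memLp_score (h : IsNoisy U Z τ μ) :
    MemLp (fun ω => score (U + Z) μ (U ω + Z ω)) 2 μ := by
  have hbound : MemLp (fun ω => (|U ω + Z ω| + √(∫ ω, U ω ^ 2 ∂μ)) / τ) 2 μ := by
    simp_rw [div_eq_mul_inv]
    exact (h.memLp_add.abs.add (memLp_const _)).mul_const _
  exact hbound.mono' (h.measurable_score.comp_aemeasurable
    h.memLp_add.aemeasurable).aestronglyMeasurable (.of_forall fun ω => h.abs_score_le _)

lemma hasFiniteFisherInfo (h : IsNoisy U Z τ μ) : HasFiniteFisherInfo (U + Z) μ :=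
  ⟨⟨_, h.isSmoothDensity⟩, h.memLp_score⟩

lemma memLp_scoreResidual (h : IsNoisy U Z τ μ) : MemLp (scoreResidual U Z τ μ) 2 μ := by
  refine h.memLp_score.add ?_
  simp_rw [div_eq_mul_inv]
  exact (h.memLp_noise ENNReal.ofNat_ne_top).mul_const _

lemma integral_mul_scoreResidual (h : IsNoisy U Z τ μ) {k : ℝ → ℝ} (hk : Measurable k)
    (hint : Integrable (fun ω => k (U ω + Z ω) * scoreResidual U Z τ μ ω) μ) :
    ∫ ω, k (U ω + Z ω) * scoreResidual U Z τ μ ω ∂μ = 0 := by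
  have := h.isProbabilityMeasure_map
  have hscore := h.measurable_score
  have hlaw := integral_add_noise (measurable_gaussianPDF 0 τ) (fun _ => gaussianPDF_lt_top)
    h.memLp.aemeasurable h.law_withDensity h.indep
    (H := fun q => k q.1 * (score (U + Z) μ q.1 + (q.1 - q.2) / τ)) (by fun_prop)
    (by simpa only [scoreResidual, add_sub_cancel_left] using hint)
  simp only [add_sub_cancel_left, toReal_gaussianPDF, mul_left_comm _ (k _),
    integral_const_mul, h.score_eq, integral_gaussScore_add, mul_zero, integral_zero] at hlaw
  simpa only [scoreResidual, h.score_eq] using hlaw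

lemma setIntegral_scoreResidual (h : IsNoisy U Z τ μ) (hadd : Measurable fun ω => U ω + Z ω)
    {t : Set ℝ} (ht : MeasurableSet t) :
    ∫ ω in (fun ω => U ω + Z ω) ⁻¹' t, scoreResidual U Z τ μ ω ∂μ = 0 := by
  have hind : (fun ω => t.indicator 1 (U ω + Z ω) * scoreResidual U Z τ μ ω) =
      ((fun ω => U ω + Z ω) ⁻¹' t).indicator (scoreResidual U Z τ μ) := by
    ext ω
    by_cases hω : U ω + Z ω ∈ t <;> simp [hω]
  have hint := (h.memLp_scoreResidual.integrable one_le_two).indicator (hadd ht)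
  rw [← integral_indicator (hadd ht), ← hind]
  exact h.integral_mul_scoreResidual (measurable_one.indicator ht) (hind ▸ hint)

end IsNoisy

lemma isNoisy_fst_snd {τ : ℝ≥0} {ν : Measure ℝ} [IsProbabilityMeasure ν] (hν : MemLp id 2 ν) :
    IsNoisy Prod.fst Prod.snd τ (ν.prod (gaussianReal 0 τ)) where
  memLp := hν.comp_measurePreserving measurePreserving_fst
  law := measurePreserving_snd.hasLaw
  indep := indepFun_prod measurable_id measurable_id

lemma gaussScore_ae_eq_condExp {τ : ℝ≥0} [NeZero τ] {ν : Measure ℝ} [IsProbabilityMeasure ν]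
    (hν : MemLp id 2 ν) :
    (fun q : ℝ × ℝ => gaussScore τ ν (q.1 + q.2)) =ᵐ[ν.prod (gaussianReal 0 τ)]
      (ν.prod (gaussianReal 0 τ))[fun q => -(q.2 / τ) |
        MeasurableSpace.comap (fun q : ℝ × ℝ => q.1 + q.2) inferInstance] := by
  have hnoisy := isNoisy_fst_snd (τ := τ) hν
  have hscore : ∀ x, score (Prod.fst + Prod.snd) (ν.prod (gaussianReal 0 τ)) x =
      gaussScore τ ν x := by
    simp [hnoisy.score_eq, measurePreserving_fst.map_eq]
  have hint := hnoisy.memLp_score.integrable one_le_two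
  have hint_noise := ((hnoisy.memLp_noise ENNReal.ofNat_ne_top).integrable one_le_two).div_const
    (τ : ℝ)
  simp only [hscore] at hint
  refine ae_eq_condExp_of_forall_setIntegral_eq (measurable_fst.add measurable_snd).comap_le
    hint_noise.neg (fun _ _ _ => hint.integrableOn) ?_
    ((measurable_gaussScore.comp (comap_measurable _)).aestronglyMeasurable)
  rintro _ ⟨t, ht, rfl⟩ -
  have hzero := hnoisy.setIntegral_scoreResidual (by fun_prop) ht
  simp only [scoreResidual, hscore] at hzero
  rw [integral_add hint.integrableOn hint_noise.integrableOn] at hzero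
  rw [integral_neg]
  exact eq_neg_of_add_eq_zero_left hzero

lemma IsNoisy.eLpNorm_score_le {Ω : Type*} [MeasurableSpace Ω] {μ : Measure Ω}
    [IsProbabilityMeasure μ] {U Z : Ω → ℝ} {τ : ℝ≥0} [NeZero τ] (h : IsNoisy U Z τ μ)
    {p : ℝ≥0∞} (hp : 1 ≤ p) :
    eLpNorm (fun ω => score (U + Z) μ (U ω + Z ω)) p μ ≤
      eLpNorm (fun z : ℝ => z / τ) p (gaussianReal 0 τ) := by
  have := h.isProbabilityMeasure_map
  have hid : MemLp id 2 (μ.map U) :=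
    (memLp_map_measure_iff (by fun_prop) h.memLp.aemeasurable).2 h.memLp
  have hlaw := h.indep.hasLaw_prod ⟨h.memLp.aemeasurable, rfl⟩ h.law
  calc eLpNorm (fun ω => score (U + Z) μ (U ω + Z ω)) p μ
      = eLpNorm (fun q : ℝ × ℝ => gaussScore τ (μ.map U) (q.1 + q.2)) p
          ((μ.map U).prod (gaussianReal 0 τ)) := by
        have hmeas : Measurable fun q : ℝ × ℝ => gaussScore τ (μ.map U) (q.1 + q.2) :=
          measurable_gaussScore.comp (measurable_fst.add measurable_snd)
        rw [← hlaw.map_eq, eLpNorm_map_measure hmeas.aestronglyMeasurable hlaw.aemeasurable,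
          h.score_eq]
        rfl
    _ ≤ eLpNorm (fun q : ℝ × ℝ => -(q.2 / τ)) p ((μ.map U).prod (gaussianReal 0 τ)) := by
        rw [eLpNorm_congr_ae (gaussScore_ae_eq_condExp hid)]
        exact eLpNorm_condExp_le_eLpNorm _ hp
    _ = eLpNorm (fun z : ℝ => z / τ) p (gaussianReal 0 τ) :=
        (eLpNorm_neg (fun q : ℝ × ℝ => q.2 / (τ : ℝ)) p _).trans
          (eLpNorm_comp_measurePreserving (g := fun z : ℝ => z / (τ : ℝ)) (by fun_prop)
            measurePreserving_snd)

/-- `S` and `T` are positively quadrant dependent in the sense of Lehmann, expressed through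
covariances of monotone functions of the single variables. -/
def IsPQD {Ω : Type*} [MeasurableSpace Ω] (S T : Ω → ℝ) (μ : Measure Ω) : Prop :=
  ∀ f g : ℝ → ℝ, Monotone f → Monotone g →
    MemLp (fun ω => f (S ω)) 2 μ → MemLp (fun ω => g (T ω)) 2 μ →
      0 ≤ cov[fun ω => f (S ω), fun ω => g (T ω); μ]

lemma IsFKG.isPQD {Ω : Type*} [MeasurableSpace Ω] {μ : Measure Ω} {S T : Ω → ℝ}
    (h : IsFKG ![S, T] μ) : IsPQD S T μ := fun f g hf hg hfS hgT =>
  h (fun v => f (v 0)) (fun v => g (v 1)) (fun _ _ hv => hf (hv 0)) (fun _ _ hv => hg (hv 1))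
    (hf.measurable.comp (measurable_pi_apply 0)) (hg.measurable.comp (measurable_pi_apply 1))
    hfS hgT

lemma IsPQD.symm {Ω : Type*} [MeasurableSpace Ω] {μ : Measure Ω} {S T : Ω → ℝ}
    (h : IsPQD S T μ) : IsPQD T S μ := fun f g hf hg hfT hgS =>
  covariance_comm (μ := μ) _ _ ▸ h g f hg hf hgS hfT

lemma monotone_const_mul_add_of_lipschitzWith {f : ℝ → ℝ} {A : ℝ≥0} (hf : LipschitzWith A f) :
    Monotone fun y => A * y + f y := fun y z hyz => by
  have hdist := hf.dist_le_mul z y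
  rw [Real.dist_eq, Real.dist_eq, abs_of_nonneg (sub_nonneg.2 hyz)] at hdist
  linarith [neg_abs_le (f z - f y)]

namespace IsPQD

variable {Ω : Type*} [MeasurableSpace Ω] {μ : Measure Ω} [IsProbabilityMeasure μ] {S T : Ω → ℝ}
  {f g : ℝ → ℝ} {A B : ℝ≥0}

lemma covariance_lipschitz_nonneg (h : IsPQD S T μ) (hS : MemLp S 2 μ) (hT : MemLp T 2 μ)
    (hf : LipschitzWith A f) (hg : LipschitzWith B g) (hfS : MemLp (fun ω => f (S ω)) 2 μ)
    (hgT : MemLp (fun ω => g (T ω)) 2 μ) :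
    0 ≤ A * B * cov[S, T; μ] + A * cov[S, fun ω => g (T ω); μ] +
      B * cov[fun ω => f (S ω), T; μ] + cov[fun ω => f (S ω), fun ω => g (T ω); μ] := by
  have hAS := hS.const_mul (A : ℝ)
  have hBT := hT.const_mul (B : ℝ)
  have hpos := h _ _ (monotone_const_mul_add_of_lipschitzWith hf)
    (monotone_const_mul_add_of_lipschitzWith hg) (hAS.add hfS) (hBT.add hgT)
  change 0 ≤ cov[(fun ω => A * S ω) + fun ω => f (S ω),
    (fun ω => B * T ω) + fun ω => g (T ω); μ] at hpos
  rw [covariance_add_left hAS hfS (hBT.add hgT), covariance_add_right hAS hBT hgT,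
    covariance_add_right hfS hBT hgT] at hpos
  simp only [covariance_const_mul_left, covariance_const_mul_right] at hpos
  linarith

lemma abs_covariance_lipschitz_le (h : IsPQD S T μ) (hS : MemLp S 2 μ) (hT : MemLp T 2 μ)
    (hf : LipschitzWith A f) (hg : LipschitzWith B g) (hfS : MemLp (fun ω => f (S ω)) 2 μ)
    (hgT : MemLp (fun ω => g (T ω)) 2 μ) :
    |cov[fun ω => f (S ω), fun ω => g (T ω); μ]| ≤ A * B * cov[S, T; μ] := by
  have h_pp := h.covariance_lipschitz_nonneg hS hT hf hg hfS hgT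
  have h_pn := h.covariance_lipschitz_nonneg hS hT hf hg.neg hfS hgT.neg
  have h_np := h.covariance_lipschitz_nonneg hS hT hf.neg hg hfS.neg hgT
  have h_nn := h.covariance_lipschitz_nonneg hS hT hf.neg hg.neg hfS.neg hgT.neg
  simp only [Pi.neg_apply, covariance_fun_neg_left, covariance_fun_neg_right] at h_pn h_np h_nn
  exact abs_le.2 ⟨by linarith, by linarith⟩

end IsPQD

lemma mix_add {Ω : Type*} (X Y X' Y' : Ω → ℝ) (β : ℝ) :
    mix (X + X') (Y + Y') β = mix X Y β + mix X' Y' β := by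
  ext ω
  simp only [mix, Pi.add_apply]
  ring

/-- `S`, `T` are positively quadrant dependent with second moments at most `K`, and `ZS`, `ZT` are
`N(0, τ)` variables which are independent of `(S, T)` and of each other. -/
structure IsPQDPairWithNoise {Ω : Type*} [MeasurableSpace Ω] (S T ZS ZT : Ω → ℝ)
    (K : ℝ) (τ : ℝ≥0) (μ : Measure Ω) : Prop where
  pqd : IsPQD S T μ
  memLp_S : MemLp S 2 μ
  memLp_T : MemLp T 2 μ
  sq_S : ∫ ω, S ω ^ 2 ∂μ ≤ K
  sq_T : ∫ ω, T ω ^ 2 ∂μ ≤ K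
  law_ZS : HasLaw ZS (gaussianReal 0 τ) μ
  law_ZT : HasLaw ZT (gaussianReal 0 τ) μ
  indep_noise : IndepFun ZS ZT μ
  indep : IndepFun (fun ω => (S ω, T ω)) (fun ω => (ZS ω, ZT ω)) μ

lemma IsFKGPairWithNoise.isPQDPairWithNoise {Ω : Type*} [MeasurableSpace Ω] {μ : Measure Ω}
    {S T ZS ZT : Ω → ℝ} {K : ℝ} {τ : ℝ≥0} (h : IsFKGPairWithNoise S T ZS ZT K τ μ) :
    IsPQDPairWithNoise S T ZS ZT K τ μ :=
  { h with
    pqd := h.fkg.isPQD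
    sq_S := (variance_of_integral_eq_zero h.memLp_S.aemeasurable h.mean_S).symm.trans_le h.var_S
    sq_T := (variance_of_integral_eq_zero h.memLp_T.aemeasurable h.mean_T).symm.trans_le h.var_T }

lemma sq_sqrt_add_sq_sqrt_one_sub {β : ℝ} (hβ : β ∈ Icc (0 : ℝ) 1) :
    √β ^ 2 + √(1 - β) ^ 2 = 1 := by
  rw [Real.sq_sqrt hβ.1, Real.sq_sqrt (sub_nonneg.2 hβ.2), add_sub_cancel]

namespace IsPQDPairWithNoise

variable {Ω : Type*} [MeasurableSpace Ω] {μ : Measure Ω} {S T ZS ZT : Ω → ℝ} {K : ℝ} {τ : ℝ≥0}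

lemma symm (h : IsPQDPairWithNoise S T ZS ZT K τ μ) : IsPQDPairWithNoise T S ZT ZS K τ μ where
  pqd := h.pqd.symm
  memLp_S := h.memLp_T
  memLp_T := h.memLp_S
  sq_S := h.sq_T
  sq_T := h.sq_S
  law_ZS := h.law_ZT
  law_ZT := h.law_ZS
  indep_noise := h.indep_noise.symm
  indep := h.indep.comp measurable_swap measurable_swap

lemma covariance_nonneg (h : IsPQDPairWithNoise S T ZS ZT K τ μ) : 0 ≤ cov[S, T; μ] :=
  h.pqd _ _ monotone_id monotone_id h.memLp_S h.memLp_T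

lemma isNoisy_left (h : IsPQDPairWithNoise S T ZS ZT K τ μ) : IsNoisy S ZS τ μ where
  memLp := h.memLp_S
  law := h.law_ZS
  indep := h.indep.comp measurable_fst measurable_fst

lemma aemeasurable_noisy (h : IsPQDPairWithNoise S T ZS ZT K τ μ) :
    AEMeasurable (fun ω => (S ω + ZS ω, T ω + ZT ω)) μ :=
  h.isNoisy_left.memLp_add.aemeasurable.prodMk h.symm.isNoisy_left.memLp_add.aemeasurable

lemma isNoisy_mix (h : IsPQDPairWithNoise S T ZS ZT K τ μ) {β : ℝ} (hβ : β ∈ Icc (0 : ℝ) 1) :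
    IsNoisy (mix S T β) (mix ZS ZT β) τ μ where
  memLp := (h.memLp_S.const_mul _).add (h.memLp_T.const_mul _)
  law := by
    have hS := gaussianReal_const_mul h.law_ZS (√β)
    have hT := gaussianReal_const_mul h.law_ZT (√(1 - β))
    refine ⟨hS.aemeasurable.add hT.aemeasurable, (gaussianReal_add_gaussianReal_of_indepFun
      (h.indep_noise.comp (measurable_const_mul _) (measurable_const_mul _))
      hS.map_eq hT.map_eq).trans ?_⟩
    congr 1
    · simp only [mul_zero, add_zero]
    · refine NNReal.coe_injective ?_
      push_cast
      rw [← add_mul]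
      exact (congrArg (· * (τ : ℝ)) (sq_sqrt_add_sq_sqrt_one_sub hβ)).trans (one_mul _)
  indep := h.indep.comp (φ := fun p : ℝ × ℝ => √β * p.1 + √(1 - β) * p.2)
    (ψ := fun p : ℝ × ℝ => √β * p.1 + √(1 - β) * p.2) (by fun_prop) (by fun_prop)

lemma integral_sq_mix_le (h : IsPQDPairWithNoise S T ZS ZT K τ μ) {β : ℝ}
    (hβ : β ∈ Icc (0 : ℝ) 1) : ∫ ω, mix S T β ω ^ 2 ∂μ ≤ 2 * K := by
  have hS := h.memLp_S.integrable_sq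
  have hT := h.memLp_T.integrable_sq
  have hpoint : ∀ ω, mix S T β ω ^ 2 ≤ S ω ^ 2 + T ω ^ 2 := fun ω => by
    calc mix S T β ω ^ 2 ≤ (√β ^ 2 + √(1 - β) ^ 2) * (S ω ^ 2 + T ω ^ 2) := by
          unfold mix
          nlinarith [sq_nonneg (√β * T ω - √(1 - β) * S ω)]
      _ = S ω ^ 2 + T ω ^ 2 := by rw [sq_sqrt_add_sq_sqrt_one_sub hβ, one_mul]
  calc ∫ ω, mix S T β ω ^ 2 ∂μ ≤ ∫ ω, (S ω ^ 2 + T ω ^ 2) ∂μ :=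
        integral_mono_of_nonneg (.of_forall fun ω => sq_nonneg _) (hS.add hT) (.of_forall hpoint)
    _ = ∫ ω, S ω ^ 2 ∂μ + ∫ ω, T ω ^ 2 ∂μ := integral_add hS hT
    _ ≤ 2 * K := by linarith [h.sq_S, h.sq_T]

lemma hasLaw_noise [NeZero τ] [IsFiniteMeasure μ] (h : IsPQDPairWithNoise S T ZS ZT K τ μ) :
    HasLaw (fun ω => (ZS ω, ZT ω)) ((volume : Measure (ℝ × ℝ)).withDensity
      fun p => gaussianPDF 0 τ p.1 * gaussianPDF 0 τ p.2) μ := by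
  have hlaw := h.indep_noise.hasLaw_prod h.law_ZS h.law_ZT
  rwa [gaussianReal_of_var_ne_zero 0 (NeZero.ne τ), prod_withDensity (by fun_prop) (by fun_prop)]
    at hlaw

variable [IsProbabilityMeasure μ]

lemma covariance_le (h : IsPQDPairWithNoise S T ZS ZT K τ μ) : cov[S, T; μ] ≤ K := by
  have hS := variance_le_expectation_sq h.memLp_S.1
  have hT := variance_le_expectation_sq h.memLp_T.1
  have hsub := variance_sub h.memLp_S h.memLp_T
  have hS' := h.sq_S
  have hT' := h.sq_T
  simp only [Pi.pow_apply] at hS hT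
  linarith [variance_nonneg (S - T) μ]

lemma hasFiniteFisherInfo [NeZero τ] (h : IsPQDPairWithNoise S T ZS ZT K τ μ) {β : ℝ}
    (hβ : β ∈ Icc (0 : ℝ) 1) :
    HasFiniteFisherInfo (S + ZS) μ ∧ HasFiniteFisherInfo (T + ZT) μ ∧
      HasFiniteFisherInfo (mix (S + ZS) (T + ZT) β) μ :=
  ⟨h.isNoisy_left.hasFiniteFisherInfo, h.symm.isNoisy_left.hasFiniteFisherInfo,
    mix_add S T ZS ZT β ▸ (h.isNoisy_mix hβ).hasFiniteFisherInfo⟩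

lemma integral_noise_mul_eq_zero (h : IsPQDPairWithNoise S T ZS ZT K τ μ) {k : ℝ → ℝ}
    (hk : Measurable k) (hint : Integrable (fun ω => ZS ω * k (T ω + ZT ω)) μ) :
    ∫ ω, ZS ω * k (T ω + ZT ω) ∂μ = 0 := by
  have hST : AEMeasurable (fun ω => (S ω, T ω)) μ := h.memLp_S.aemeasurable.prodMk
    h.memLp_T.aemeasurable
  have hlaw := h.indep.hasLaw_prod ⟨hST, rfl⟩ (h.indep_noise.hasLaw_prod h.law_ZS h.law_ZT)
  have hH : Measurable fun p : (ℝ × ℝ) × (ℝ × ℝ) => p.2.1 * k (p.1.2 + p.2.2) := by fun_prop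
  have hint' := (integrable_map_measure hH.aestronglyMeasurable hlaw.aemeasurable).2 hint
  have := Measure.isProbabilityMeasure_map hST
  rw [hlaw.map_eq] at hint'
  have hinner : ∀ t : ℝ, ∫ z : ℝ × ℝ, z.1 * k (t + z.2)
      ∂(gaussianReal 0 τ).prod (gaussianReal 0 τ) = 0 := fun t => by
    rw [integral_prod_mul (fun x : ℝ => x) (fun y => k (t + y)), integral_id_gaussianReal, zero_mul]
  refine (hlaw.integral_comp hH.aestronglyMeasurable).trans ?_
  simp only [integral_prod _ hint', hinner, integral_zero]

end IsPQDPairWithNoise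

lemma integral_sq_expansion {Ω : Type*} [MeasurableSpace Ω] {μ : Measure Ω}
    {RX RY RW NX NY : Ω → ℝ} {a b : ℝ} (hRX : MemLp RX 2 μ) (hRY : MemLp RY 2 μ)
    (hRW : MemLp RW 2 μ) (hNX : MemLp NX 2 μ) (hNY : MemLp NY 2 μ)
    (hW : ∫ ω, RW ω * (RW ω + (a * NX ω + b * NY ω)) ∂μ = 0) (hXY : ∫ ω, NX ω * RY ω ∂μ = 0) :
    ∫ ω, (a * RX ω + b * RY ω - RW ω) ^ 2 ∂μ =
      a ^ 2 * ∫ ω, RX ω ^ 2 ∂μ + b ^ 2 * ∫ ω, RY ω ^ 2 ∂μ - ∫ ω, RW ω ^ 2 ∂μ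
      - 2 * a * ∫ ω, (RW ω - b * RY ω) * (RX ω + NX ω) ∂μ
      - 2 * b * ∫ ω, RW ω * (RY ω + NY ω) ∂μ := by
  have hX2 := hRX.integrable_sq
  have hY2 := hRY.integrable_sq
  have hW2 := hRW.integrable_sq
  have hWX : Integrable (fun ω => (RW ω - b * RY ω) * (RX ω + NX ω)) μ :=
    (hRW.sub (hRY.const_mul b)).integrable_mul (hRX.add hNX)
  have hWY : Integrable (fun ω => RW ω * (RY ω + NY ω)) μ := hRW.integrable_mul (hRY.add hNY)
  have hWW : Integrable (fun ω => RW ω * (RW ω + (a * NX ω + b * NY ω))) μ :=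
    hRW.integrable_mul (hRW.add ((hNX.const_mul a).add (hNY.const_mul b)))
  have hNY : Integrable (fun ω => NX ω * RY ω) μ := hNX.integrable_mul hRY
  have hpoint : ∀ ω, (a * RX ω + b * RY ω - RW ω) ^ 2 =
      a ^ 2 * RX ω ^ 2 + b ^ 2 * RY ω ^ 2 - RW ω ^ 2
      - 2 * a * ((RW ω - b * RY ω) * (RX ω + NX ω)) - 2 * b * (RW ω * (RY ω + NY ω))
      + 2 * (RW ω * (RW ω + (a * NX ω + b * NY ω))) - 2 * a * b * (NX ω * RY ω) := fun ω => by ring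
  simp_rw [hpoint]
  rw [integral_sub (by fun_prop) (by fun_prop), integral_add (by fun_prop) (by fun_prop),
    integral_sub (by fun_prop) (by fun_prop), integral_sub (by fun_prop) (by fun_prop),
    integral_sub (by fun_prop) (by fun_prop), integral_add (by fun_prop) (by fun_prop)]
  simp only [integral_const_mul, hW, hXY]
  ring

lemma IsPQDPairWithNoise.scoreGap_eq {Ω : Type*} [MeasurableSpace Ω] {μ : Measure Ω}
    [IsProbabilityMeasure μ] {S T ZS ZT : Ω → ℝ} {K : ℝ} {τ : ℝ≥0} [NeZero τ]
    (h : IsPQDPairWithNoise S T ZS ZT K τ μ) {β : ℝ} (hβ : β ∈ Icc (0 : ℝ) 1) :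
    scoreGap (S + ZS) (T + ZT) β μ =
      β * fisherInfo (S + ZS) μ + (1 - β) * fisherInfo (T + ZT) μ
        - fisherInfo (mix (S + ZS) (T + ZT) β) μ
      - 2 * √β * ∫ ω, (score (mix (S + ZS) (T + ZT) β) μ (mix (S + ZS) (T + ZT) β ω)
          - √(1 - β) * score (T + ZT) μ (T ω + ZT ω)) * scoreResidual S ZS τ μ ω ∂μ
      - 2 * √(1 - β) * ∫ ω, score (mix (S + ZS) (T + ZT) β) μ (mix (S + ZS) (T + ZT) β ω) *
          scoreResidual T ZT τ μ ω ∂μ := by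
  obtain ⟨⟨-, hX⟩, ⟨-, hY⟩, ⟨-, hW⟩⟩ := h.hasFiniteFisherInfo hβ
  have hnoise : ∀ {U Z : Ω → ℝ}, IsNoisy U Z τ μ → MemLp (fun ω => Z ω / τ) 2 μ :=
    fun {U Z} hUZ => by
      simp_rw [div_eq_mul_inv]
      exact (hUZ.memLp_noise ENNReal.ofNat_ne_top).mul_const _
  have hZS := hnoise h.isNoisy_left
  have hZT := hnoise h.symm.isNoisy_left
  have hmix := h.isNoisy_mix hβ
  have hWW : ∫ ω, score (mix (S + ZS) (T + ZT) β) μ (mix (S + ZS) (T + ZT) β ω) *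
      (score (mix (S + ZS) (T + ZT) β) μ (mix (S + ZS) (T + ZT) β ω) +
        (√β * (ZS ω / τ) + √(1 - β) * (ZT ω / τ))) ∂μ = 0 := by
    simp_rw [← mul_div_assoc, ← add_div, mix_add]
    exact hmix.integral_mul_scoreResidual hmix.measurable_score
      (hmix.memLp_score.integrable_mul hmix.memLp_scoreResidual)
  have hXY : ∫ ω, ZS ω / τ * score (T + ZT) μ ((T + ZT) ω) ∂μ = 0 := by
    simp_rw [div_mul_eq_mul_div]
    rw [integral_div, div_eq_zero_iff]
    exact .inl (h.integral_noise_mul_eq_zero h.symm.isNoisy_left.measurable_score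
      ((h.isNoisy_left.memLp_noise (p := 2) ENNReal.ofNat_ne_top).integrable_mul hY))
  have hsq := integral_sq_expansion hX hY hW hZS hZT hWW hXY
  rwa [Real.sq_sqrt hβ.1, Real.sq_sqrt (sub_nonneg.2 hβ.2)] at hsq

section Box

variable {Ω : Type*} [MeasurableSpace Ω] {μ : Measure Ω} [IsProbabilityMeasure μ]
  {S T ZS ZT : Ω → ℝ} {K : ℝ} {τ L : ℝ≥0} [NeZero τ]

lemma IsPQD.abs_integral_gaussianPDFReal_mul_le (h : IsPQD S T μ) (hS : MemLp S 2 μ)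
    (hT : MemLp T 2 μ) (hL : LipschitzWith L (polyGauss τ 1))
    (hL' : LipschitzWith L (polyGauss τ (polyGaussDeriv τ 1))) (x y : ℝ) :
    |∫ ω, gaussianPDFReal 0 τ (x - S ω) * gaussianPDFReal 0 τ (y - T ω) *
        (gaussScore τ (μ.map S) x + (x - S ω) / τ) ∂μ| ≤
      (|gaussScore τ (μ.map S) x| + 1) * L ^ 2 * cov[S, T; μ] := by
  have := Measure.isProbabilityMeasure_map hS.aemeasurable
  set ρ := gaussScore τ (μ.map S) x with hρ
  let f : ℝ → ℝ := fun s => ρ * polyGauss τ 1 (x - s) - polyGauss τ (polyGaussDeriv τ 1) (x - s)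
  let g : ℝ → ℝ := fun t => polyGauss τ 1 (y - t)
  have hf_eq : ∀ s, f s = gaussianPDFReal 0 τ (x - s) * (ρ + (x - s) / τ) := fun s => by
    simp only [f, polyGauss_one, polyGauss_polyGaussDeriv_one]
    ring
  have hsub : ∀ z : ℝ, LipschitzWith 1 fun s => z - s := fun z =>
    (IsometryEquiv.subLeft z).isometry.lipschitz
  have hf : LipschitzWith (‖ρ‖₊ * (L * 1) + L * 1) f :=
    ((lipschitzWith_smul ρ).comp (hL.comp (hsub x))).sub (hL'.comp (hsub x))
  have hg : LipschitzWith (L * 1) g := hL.comp (hsub y)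
  have hfS : MemLp (fun ω => f (S ω)) 2 μ :=
    ((memLp_polyGauss_sub hS.aemeasurable x 2).const_mul ρ).sub
      (memLp_polyGauss_sub hS.aemeasurable x 2)
  have hgT : MemLp (fun ω => g (T ω)) 2 μ := memLp_polyGauss_sub hT.aemeasurable y 2
  have hf_zero : ∫ ω, f (S ω) ∂μ = 0 := by
    rw [← integral_map hS.aemeasurable hf.continuous.aestronglyMeasurable]
    simp only [hf_eq, hρ, integral_gaussScore_add]
  have hcov := h.abs_covariance_lipschitz_le hS hT hf hg hfS hgT
  rw [covariance_eq_sub hfS hgT, hf_zero, zero_mul, sub_zero] at hcov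
  convert! hcov using 1
  · refine congrArg abs (integral_congr_ae (.of_forall fun ω => ?_))
    simp only [Pi.mul_apply, hf_eq, g, polyGauss_one]
    ring
  · push_cast
    rw [Real.norm_eq_abs]
    ring

lemma volume_real_closedBall_prod {B : ℝ} (hB : 0 ≤ B) :
    volume.real (Metric.closedBall (0 : ℝ × ℝ) B) = (2 * B) ^ 2 := by
  change volume.real (Metric.closedBall ((0 : ℝ), (0 : ℝ)) B) = _
  rw [← closedBall_prod_same, Measure.volume_eq_prod, measureReal_prod_prod,
    Real.volume_real_closedBall hB, sq]

namespace IsPQDPairWithNoise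

lemma integral_mul_scoreResidual_eq (h : IsPQDPairWithNoise S T ZS ZT K τ μ) {k : ℝ × ℝ → ℝ}
    (hk : Measurable k)
    (hint : Integrable (fun ω => k (S ω + ZS ω, T ω + ZT ω) * scoreResidual S ZS τ μ ω) μ) :
    ∫ ω, k (S ω + ZS ω, T ω + ZT ω) * scoreResidual S ZS τ μ ω ∂μ =
      ∫ p : ℝ × ℝ, k p * ∫ ω, gaussianPDFReal 0 τ (p.1 - S ω) * gaussianPDFReal 0 τ (p.2 - T ω) *
        (gaussScore τ (μ.map S) p.1 + (p.1 - S ω) / τ) ∂μ := by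
  have := h.isNoisy_left.isProbabilityMeasure_map
  have hscore := measurable_gaussScore (τ := τ) (ν := μ.map S)
  have hST : AEMeasurable (fun ω => (S ω, T ω)) μ :=
    h.memLp_S.aemeasurable.prodMk h.memLp_T.aemeasurable
  have hlaw := integral_add_noise (by fun_prop)
    (fun p => ENNReal.mul_lt_top gaussianPDF_lt_top gaussianPDF_lt_top) hST h.hasLaw_noise h.indep
    (H := fun q => k q.1 * (gaussScore τ (μ.map S) q.1.1 + (q.1.1 - q.2.1) / τ)) (by fun_prop)
    (by simpa only [Prod.mk_add_mk, add_sub_cancel_left, scoreResidual, h.isNoisy_left.score_eq]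
      using hint)
  simp only [Prod.mk_add_mk, add_sub_cancel_left, Prod.fst_sub, Prod.snd_sub, ENNReal.toReal_mul,
    toReal_gaussianPDF, mul_left_comm _ (k _), integral_const_mul] at hlaw
  simp only [scoreResidual, h.isNoisy_left.score_eq, hlaw]
  refine integral_congr_ae (.of_forall fun p => congrArg (k p * ·) ?_)
  exact integral_map hST (by fun_prop)

lemma abs_setIntegral_closedBall_le (h : IsPQDPairWithNoise S T ZS ZT K τ μ)
    (hL : LipschitzWith L (polyGauss τ 1))
    (hL' : LipschitzWith L (polyGauss τ (polyGaussDeriv τ 1)))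
    {k : ℝ × ℝ → ℝ} (hk : Measurable k) {B M : ℝ} (hB : 0 ≤ B) (hM : ∀ p, ‖p‖ ≤ B → |k p| ≤ M) :
    |∫ ω in {ω | ‖(S ω + ZS ω, T ω + ZT ω)‖ ≤ B},
        k (S ω + ZS ω, T ω + ZT ω) * scoreResidual S ZS τ μ ω ∂μ| ≤
      M * (((B + √K) / τ + 1) * L ^ 2 * cov[S, T; μ]) * (2 * B) ^ 2 := by
  set Q : Set (ℝ × ℝ) := Metric.closedBall 0 B with hQ
  have hQm : MeasurableSet Q := Metric.isClosed_closedBall.measurableSet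
  have hM' : ∀ p ∈ Q, |k p| ≤ M := fun p hp => hM p (mem_closedBall_zero_iff.1 hp)
  have hM0 : 0 ≤ M := (abs_nonneg _).trans (hM 0 (by simpa using hB))
  have hbdd : ∀ p, ‖Q.indicator k p‖ ≤ M := fun p => by
    by_cases hp : p ∈ Q <;> simp [hp, hM', hM0]
  have hset : {ω | ‖(S ω + ZS ω, T ω + ZT ω)‖ ≤ B} =
      (fun ω => (S ω + ZS ω, T ω + ZT ω)) ⁻¹' Q := by ext ω; simp [hQ]
  have hind : (fun ω => Q.indicator k (S ω + ZS ω, T ω + ZT ω) * scoreResidual S ZS τ μ ω) =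
      ((fun ω => (S ω + ZS ω, T ω + ZT ω)) ⁻¹' Q).indicator
        fun ω => k (S ω + ZS ω, T ω + ZT ω) * scoreResidual S ZS τ μ ω := by
    ext ω
    by_cases hω : (S ω + ZS ω, T ω + ZT ω) ∈ Q <;> simp [hω]
  have hint : Integrable
      (fun ω => Q.indicator k (S ω + ZS ω, T ω + ZT ω) * scoreResidual S ZS τ μ ω) μ :=
    (h.isNoisy_left.memLp_scoreResidual.integrable one_le_two).bdd_mul
      ((hk.indicator hQm).comp_aemeasurable h.aemeasurable_noisy).aestronglyMeasurable
      (.of_forall fun ω => hbdd _)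
  rw [hset, ← integral_indicator₀ (h.aemeasurable_noisy.nullMeasurableSet_preimage hQm), ← hind,
    h.integral_mul_scoreResidual_eq (hk.indicator hQm) hint,
    ← setIntegral_eq_integral_of_forall_compl_eq_zero (s := Q) (fun p hp => by simp [hp]),
    ← volume_real_closedBall_prod hB, ← Real.norm_eq_abs]
  refine norm_setIntegral_le_of_norm_le_const
    (isCompact_closedBall (0 : ℝ × ℝ) B).measure_lt_top fun p hp => ?_
  have hscore : |gaussScore τ (μ.map S) p.1| ≤ (B + √K) / τ := by
    rw [← h.isNoisy_left.score_eq]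
    refine (h.isNoisy_left.abs_score_le p.1).trans ?_
    gcongr
    · exact (norm_fst_le p).trans (mem_closedBall_zero_iff.1 hp)
    · exact h.sq_S
  have hc := h.covariance_nonneg
  rw [norm_mul]
  gcongr
  · exact hbdd p
  · exact (h.pqd.abs_integral_gaussianPDFReal_mul_le h.memLp_S h.memLp_T hL hL' p.1 p.2).trans
      (by gcongr)

end IsPQDPairWithNoise

end Box

lemma abs_setIntegral_mul_le {Ω : Type*} [MeasurableSpace Ω] {μ : Measure Ω} [IsFiniteMeasure μ]
    {f g : Ω → ℝ} {q N N' : ℝ≥0} (hq : 1 ≤ q) (hf : AEStronglyMeasurable f μ)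
    (hg : AEStronglyMeasurable g μ) (hN : eLpNorm f (2 * q) μ ≤ N)
    (hN' : eLpNorm g (2 * q) μ ≤ N') (E : Set Ω) :
    |∫ ω in E, f ω * g ω ∂μ| ≤ N * N' * μ.real E ^ (1 - 1 / (q : ℝ)) := by
  have : ENNReal.HolderTriple (2 * q) (2 * q) q := ⟨by
    rw [ENNReal.mul_inv (by simp) (by simp), ← add_mul, ENNReal.inv_two_add_inv_two, one_mul]⟩
  have hexp : 0 ≤ 1 - 1 / (q : ℝ) :=
    sub_nonneg.2 (div_le_one_of_le₀ (by exact_mod_cast hq) q.coe_nonneg)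
  have hmul : ‖∫ ω in E, f ω * g ω ∂μ‖ₑ ≤ N * N' * μ E ^ (1 - 1 / (q : ℝ)) := by
    calc ‖∫ ω in E, f ω * g ω ∂μ‖ₑ ≤ eLpNorm (f • g) 1 (μ.restrict E) :=
          (enorm_integral_le_lintegral_enorm _).trans_eq eLpNorm_one_eq_lintegral_enorm.symm
      _ ≤ eLpNorm (f • g) q (μ.restrict E) * μ E ^ (1 - 1 / (q : ℝ)) := by
          simpa using eLpNorm_le_eLpNorm_mul_rpow_measure_univ (μ := μ.restrict E) (p := 1)
            (q := q) (by exact_mod_cast hq) (hf.mul hg).restrict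
      _ ≤ N * N' * μ E ^ (1 - 1 / (q : ℝ)) := by
          gcongr
          calc eLpNorm (f • g) q (μ.restrict E) ≤ eLpNorm (f • g) q μ := eLpNorm_restrict_le _ _ _ _
            _ ≤ eLpNorm f (2 * q) μ * eLpNorm g (2 * q) μ := eLpNorm_smul_le_mul_eLpNorm hg hf
            _ ≤ N * N' := mul_le_mul' hN hN'
  have hfin : N * N' * μ E ^ (1 - 1 / (q : ℝ)) ≠ ∞ := ENNReal.mul_ne_top
    (ENNReal.mul_ne_top ENNReal.coe_ne_top ENNReal.coe_ne_top)
    (ENNReal.rpow_ne_top_of_nonneg hexp (measure_ne_top μ E))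
  simpa [measureReal_def, ENNReal.toReal_rpow] using ENNReal.toReal_mono hfin hmul

lemma measureReal_le_abs_le {Ω : Type*} [MeasurableSpace Ω] {μ : Measure Ω} [IsFiniteMeasure μ]
    {U : Ω → ℝ} {r t : ℝ} (hr : 0 ≤ r) (ht : 0 < t) (hU : Integrable (fun ω => |U ω| ^ r) μ) :
    μ.real {ω | t ≤ |U ω|} ≤ t ^ (-r) * ∫ ω, |U ω| ^ r ∂μ := by
  have hsub : {ω | t ≤ |U ω|} ⊆ {ω | t ^ r ≤ |U ω| ^ r} := fun ω hω =>
    Real.rpow_le_rpow ht.le hω hr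
  have hmarkov := mul_meas_ge_le_integral_of_nonneg
    (.of_forall fun ω => Real.rpow_nonneg (abs_nonneg (U ω)) r) hU (t ^ r)
  rw [Real.rpow_neg ht.le, ← div_eq_inv_mul, le_div_iff₀' (Real.rpow_pos_of_pos ht r)]
  exact (mul_le_mul_of_nonneg_left (measureReal_mono hsub) (by positivity)).trans hmarkov

/-- The absolute moment of order `r` of `U` is finite and at most `A`. -/
def AbsMomentLE {Ω : Type*} [MeasurableSpace Ω] (U : Ω → ℝ) (r A : ℝ) (μ : Measure Ω) : Prop :=
  Integrable (fun ω => |U ω| ^ r) μ ∧ ∫ ω, |U ω| ^ r ∂μ ≤ A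

lemma integrable_abs_rpow_gaussianReal (τ : ℝ≥0) {r : ℝ} (hr : 0 < r) :
    Integrable (fun z : ℝ => |z| ^ r) (gaussianReal 0 τ) := by
  have := (memLp_id_gaussianReal' (μ := 0) (v := τ) (ENNReal.ofReal r)
    ENNReal.ofReal_ne_top).integrable_norm_rpow (by simpa using hr) ENNReal.ofReal_ne_top
  simpa [ENNReal.toReal_ofReal hr.le] using this

lemma IsPQDPairWithNoise.measureReal_lt_norm_le {Ω : Type*} [MeasurableSpace Ω] {μ : Measure Ω}
    [IsFiniteMeasure μ] {S T ZS ZT : Ω → ℝ} {K : ℝ} {τ : ℝ≥0}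
    (h : IsPQDPairWithNoise S T ZS ZT K τ μ) {r A B : ℝ} (hr : 0 < r) (hB : 0 < B)
    (hS : AbsMomentLE S r A μ) (hT : AbsMomentLE T r A μ) :
    μ.real {ω | ‖(S ω + ZS ω, T ω + ZT ω)‖ ≤ B}ᶜ ≤
      2 ^ (r + 1) * (A + ∫ z, |z| ^ r ∂gaussianReal 0 τ) * B ^ (-r) := by
  have hscale : 2 ^ (r + 1) * B ^ (-r) = 2 * (B / 2) ^ (-r) := by
    rw [Real.div_rpow hB.le two_pos.le, Real.rpow_neg two_pos.le, div_inv_eq_mul,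
      Real.rpow_add_one two_ne_zero]
    ring
  rw [mul_right_comm, hscale]
  have hZ : ∀ {Z : Ω → ℝ}, HasLaw Z (gaussianReal 0 τ) μ →
      AbsMomentLE Z r (∫ z, |z| ^ r ∂gaussianReal 0 τ) μ := fun hlaw => by
    have hm : Measurable fun z : ℝ => |z| ^ r := by fun_prop
    exact ⟨(integrable_map_measure hm.aestronglyMeasurable hlaw.aemeasurable).1
      (hlaw.map_eq ▸ integrable_abs_rpow_gaussianReal τ hr),
      (hlaw.integral_comp hm.aestronglyMeasurable).le⟩
  have hU : ∀ {U : Ω → ℝ} {a : ℝ}, AbsMomentLE U r a μ →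
      μ.real {ω | B / 2 ≤ |U ω|} ≤ (B / 2) ^ (-r) * a := fun h =>
    (measureReal_le_abs_le hr.le (half_pos hB) h.1).trans
      (mul_le_mul_of_nonneg_left h.2 (by positivity))
  have hsub : {ω | ‖(S ω + ZS ω, T ω + ZT ω)‖ ≤ B}ᶜ ⊆
      ({ω | B / 2 ≤ |S ω|} ∪ {ω | B / 2 ≤ |ZS ω|}) ∪
        ({ω | B / 2 ≤ |T ω|} ∪ {ω | B / 2 ≤ |ZT ω|}) := fun ω hω => by
    contrapose! hω
    simp only [mem_union, mem_ofPred_eq, not_or, not_le, mem_compl_iff, not_not, norm_prod_le_iff,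
      Real.norm_eq_abs] at hω ⊢
    constructor <;> linarith [abs_add_le (S ω) (ZS ω), abs_add_le (T ω) (ZT ω)]
  have hS' := measureReal_union_le (μ := μ) {ω | B / 2 ≤ |S ω|} {ω | B / 2 ≤ |ZS ω|}
  have hT' := measureReal_union_le (μ := μ) {ω | B / 2 ≤ |T ω|} {ω | B / 2 ≤ |ZT ω|}
  linarith [measureReal_mono (μ := μ) hsub, measureReal_union_le (μ := μ)
    ({ω | B / 2 ≤ |S ω|} ∪ {ω | B / 2 ≤ |ZS ω|}) ({ω | B / 2 ≤ |T ω|} ∪ {ω | B / 2 ≤ |ZT ω|}),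
    hU (hZ h.law_ZS), hU (hZ h.law_ZT), hU hS, hU hT]

lemma le_mul_rpow_of_forall_cutoff {D t r θ ε C₁ C₂ : ℝ} (hr : 0 < r) (hθ : 0 < θ) (hε : 0 ≤ ε)
    (hεθ : 1 - ε ≤ θ) (ht : 0 ≤ t) (ht1 : t ≤ 1) (hC₁ : 0 ≤ C₁) (hC₂ : 0 ≤ C₂)
    (h : ∀ B, 1 ≤ B → D ≤ C₁ * B ^ 4 * t + C₂ * B ^ (-(r * θ))) :
    D ≤ (C₁ + C₂) * t ^ (r / (4 + r) - ε) := by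
  obtain rfl | ht := ht.eq_or_lt
  · have hlim : Tendsto (fun B : ℝ => C₂ * B ^ (-(r * θ))) atTop (𝓝 0) := by
      simpa using (tendsto_rpow_neg_atTop (mul_pos hr hθ)).const_mul C₂
    refine (ge_of_tendsto hlim ((eventually_ge_atTop 1).mono fun B hB => ?_)).trans (by positivity)
    simpa using h B hB
  have hle : ∀ {s}, r / (4 + r) - ε ≤ s → t ^ s ≤ t ^ (r / (4 + r) - ε) := fun hs =>
    Real.rpow_le_rpow_of_exponent_ge ht ht1 hs
  -- the cutoff balancing the two terms for `θ = 1`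
  set B := t ^ (-(1 / (4 + r))) with hB
  have hbox : B ^ 4 * t ≤ t ^ (r / (4 + r) - ε) := by
    rw [hB, ← Real.rpow_mul_natCast ht.le, ← Real.rpow_add_one ht.ne']
    refine hle ?_
    calc r / (4 + r) - ε ≤ r / (4 + r) := sub_le_self _ hε
      _ = -(1 / (4 + r)) * (4 : ℕ) + 1 := by push_cast; field_simp; ring
  have htail : B ^ (-(r * θ)) ≤ t ^ (r / (4 + r) - ε) := by
    rw [hB, ← Real.rpow_mul ht.le]
    refine hle ?_
    have hfrac : r / (4 + r) ≤ 1 := (div_le_one (by positivity)).2 (by linarith)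
    have hfrac0 : 0 ≤ r / (4 + r) := by positivity
    calc r / (4 + r) - ε ≤ r / (4 + r) * θ := by nlinarith
      _ = -(1 / (4 + r)) * -(r * θ) := by ring
  calc D ≤ C₁ * (B ^ 4 * t) + C₂ * B ^ (-(r * θ)) := by
        rw [← mul_assoc]
        have hexp : -(1 / (4 + r)) ≤ 0 := neg_nonpos.2 (by positivity)
        exact h B (Real.one_le_rpow_of_pos_of_le_one_of_nonpos ht ht1 hexp)
    _ ≤ C₁ * t ^ (r / (4 + r) - ε) + C₂ * t ^ (r / (4 + r) - ε) := by gcongr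
    _ = (C₁ + C₂) * t ^ (r / (4 + r) - ε) := (add_mul _ _ _).symm

section Residual

variable {Ω : Type*} [MeasurableSpace Ω] {μ : Measure Ω} [IsProbabilityMeasure μ]
  {S T ZS ZT : Ω → ℝ} {K : ℝ} {τ : ℝ≥0} [NeZero τ]

lemma IsNoisy.eLpNorm_scoreResidual_le {U Z : Ω → ℝ} (h : IsNoisy U Z τ μ) {p : ℝ≥0∞}
    (hp : 1 ≤ p) : eLpNorm (scoreResidual U Z τ μ) p μ ≤
      2 * eLpNorm (fun z : ℝ => z / τ) p (gaussianReal 0 τ) := by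
  have hZ : eLpNorm (fun ω => Z ω / τ) p μ = eLpNorm (fun z : ℝ => z / τ) p (gaussianReal 0 τ) :=
    h.law.map_eq ▸ (eLpNorm_map_measure (g := fun z : ℝ => z / τ) (by fun_prop)
      h.law.aemeasurable).symm
  rw [two_mul]
  exact (eLpNorm_add_le h.memLp_score.1 (h.law.aemeasurable.div_const _).aestronglyMeasurable
    hp).trans (add_le_add (h.eLpNorm_score_le hp) hZ.le)

namespace IsPQDPairWithNoise

variable {k : ℝ × ℝ → ℝ} {L q N : ℝ≥0} {m r A B : ℝ}

lemma abs_setIntegral_compl_closedBall_le (h : IsPQDPairWithNoise S T ZS ZT K τ μ) (hq : 1 ≤ q)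
    (hN : 2 * eLpNorm (fun z : ℝ => z / τ) (2 * q) (gaussianReal 0 τ) ≤ N) (hk : Measurable k)
    (hkN : eLpNorm (fun ω => k (S ω + ZS ω, T ω + ZT ω)) (2 * q) μ ≤ N) (hr : 0 < r) (hB : 0 < B)
    (hS : AbsMomentLE S r A μ) (hT : AbsMomentLE T r A μ) :
    |∫ ω in {ω | ‖(S ω + ZS ω, T ω + ZT ω)‖ ≤ B}ᶜ,
        k (S ω + ZS ω, T ω + ZT ω) * scoreResidual S ZS τ μ ω ∂μ| ≤
      N * N * (2 ^ (r + 1) * (A + ∫ z, |z| ^ r ∂gaussianReal 0 τ)) ^ (1 - 1 / (q : ℝ)) *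
        B ^ (-(r * (1 - 1 / (q : ℝ)))) := by
  have hq' : (1 : ℝ) ≤ q := by exact_mod_cast hq
  have hθ : 0 ≤ 1 - 1 / (q : ℝ) := sub_nonneg.2 (div_le_one_of_le₀ hq' q.coe_nonneg)
  have hresidual := (h.isNoisy_left.eLpNorm_scoreResidual_le
    (p := 2 * q) (one_le_two.trans (le_mul_of_one_le_right' (by exact_mod_cast hq)))).trans hN
  have hholder := abs_setIntegral_mul_le hq
    (hk.comp_aemeasurable h.aemeasurable_noisy).aestronglyMeasurable
    h.isNoisy_left.memLp_scoreResidual.1 hkN hresidual {ω | ‖(S ω + ZS ω, T ω + ZT ω)‖ ≤ B}ᶜ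
  have hA : 0 ≤ A := (integral_nonneg fun ω => by positivity).trans hS.2
  have : 0 ≤ ∫ z : ℝ, |z| ^ r ∂gaussianReal 0 τ := integral_nonneg fun z => by positivity
  refine hholder.trans ?_
  rw [← neg_mul, Real.rpow_mul hB.le, mul_assoc (_ * _),
    ← Real.mul_rpow (by positivity) (by positivity)]
  gcongr
  exact h.measureReal_lt_norm_le hr hB hS hT

lemma abs_integral_mul_scoreResidual_le (h : IsPQDPairWithNoise S T ZS ZT K τ μ)
    (hL : LipschitzWith L (polyGauss τ 1))
    (hL' : LipschitzWith L (polyGauss τ (polyGaussDeriv τ 1))) (hq : 1 ≤ q)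
    (hN : 2 * eLpNorm (fun z : ℝ => z / τ) (2 * q) (gaussianReal 0 τ) ≤ N) (hk : Measurable k)
    (hkm : ∀ p, |k p| ≤ m * (1 + ‖p‖))
    (hkN : eLpNorm (fun ω => k (S ω + ZS ω, T ω + ZT ω)) (2 * q) μ ≤ N) (hr : 0 < r) (hB : 1 ≤ B)
    (hS : AbsMomentLE S r A μ) (hT : AbsMomentLE T r A μ) :
    |∫ ω, k (S ω + ZS ω, T ω + ZT ω) * scoreResidual S ZS τ μ ω ∂μ| ≤
      8 * m * L ^ 2 * ((1 + √K) / τ + 1) * B ^ 4 * cov[S, T; μ] +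
        N * N * (2 ^ (r + 1) * (A + ∫ z, |z| ^ r ∂gaussianReal 0 τ)) ^ (1 - 1 / (q : ℝ)) *
          B ^ (-(r * (1 - 1 / (q : ℝ)))) := by
  have hm : 0 ≤ m := by simpa using (abs_nonneg _).trans (hkm 0)
  have hB0 : 0 < B := one_pos.trans_le hB
  have hc := h.covariance_nonneg
  have hint : Integrable
      (fun ω => k (S ω + ZS ω, T ω + ZT ω) * scoreResidual S ZS τ μ ω) μ := by
    have hp : (2 : ℝ≥0∞) ≤ 2 * q := le_mul_of_one_le_right' (by exact_mod_cast hq)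
    have hk2 : MemLp (fun ω => k (S ω + ZS ω, T ω + ZT ω)) (2 * q) μ :=
      ⟨(hk.comp_aemeasurable h.aemeasurable_noisy).aestronglyMeasurable,
        hkN.trans_lt ENNReal.coe_lt_top⟩
    exact (hk2.mono_exponent hp).integrable_mul h.isNoisy_left.memLp_scoreResidual
  have hball := h.abs_setIntegral_closedBall_le hL hL' hk hB0.le (M := m * (1 + B)) fun p hp =>
    (hkm p).trans (by gcongr)
  have hcompl := h.abs_setIntegral_compl_closedBall_le hq hN hk hkN hr hB0 hS hT
  rw [← integral_add_compl₀ (h.aemeasurable_noisy.norm.nullMeasurableSet_preimage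
    measurableSet_Iic : NullMeasurableSet {ω | ‖(S ω + ZS ω, T ω + ZT ω)‖ ≤ B} μ) hint]
  refine (abs_add_le _ _).trans (add_le_add (hball.trans ?_) hcompl)
  calc m * (1 + B) * (((B + √K) / τ + 1) * L ^ 2 * cov[S, T; μ]) * (2 * B) ^ 2
      ≤ m * (B + B) * (((B + B * √K) / τ + B) * L ^ 2 * cov[S, T; μ]) * (2 * B) ^ 2 := by
        gcongr
        exact le_mul_of_one_le_left (Real.sqrt_nonneg K) hB
    _ = 8 * m * L ^ 2 * ((1 + √K) / τ + 1) * B ^ 4 * cov[S, T; μ] := by ring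

end IsPQDPairWithNoise

end Residual

lemma exists_nnreal_one_sub_one_div_ge {ε : ℝ} (hε : 0 < ε) :
    ∃ q : ℝ≥0, 1 ≤ q ∧ 0 < 1 - 1 / (q : ℝ) ∧ 1 - ε ≤ 1 - 1 / (q : ℝ) := by
  refine ⟨1 + Real.toNNReal ε⁻¹, le_add_of_nonneg_right zero_le, ?_⟩
  have hε' := inv_pos.2 hε
  rw [NNReal.coe_add, NNReal.coe_one, Real.coe_toNNReal _ hε'.le, sub_pos, sub_le_sub_iff_left,
    one_div]
  exact ⟨inv_lt_one_of_one_lt₀ (lt_add_of_pos_right 1 hε'), inv_le_of_inv_le₀ hε (by linarith)⟩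

lemma eLpNorm_div_gaussianReal_ne_top (τ : ℝ≥0) {p : ℝ≥0∞} (hp : p ≠ ∞) :
    eLpNorm (fun z : ℝ => z / τ) p (gaussianReal 0 τ) ≠ ∞ := by
  simp_rw [div_eq_mul_inv]
  exact ((memLp_id_gaussianReal' p hp).mul_const _).eLpNorm_ne_top

lemma exists_forall_abs_integral_mul_scoreResidual_le (K m A : ℝ) (τ : ℝ≥0) [NeZero τ] {r ε : ℝ}
    (hr : 0 < r) (hε : 0 < ε) :
    ∃ C : ℝ, ∀ (Ω : Type u) [MeasurableSpace Ω] (μ : Measure Ω) [IsProbabilityMeasure μ]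
      (S T ZS ZT : Ω → ℝ), IsPQDPairWithNoise S T ZS ZT K τ μ → AbsMomentLE S r A μ →
      AbsMomentLE T r A μ → ∀ k : ℝ × ℝ → ℝ, Measurable k → (∀ p, |k p| ≤ m * (1 + ‖p‖)) →
      (∀ p : ℝ≥0∞, 1 ≤ p → eLpNorm (fun ω => k (S ω + ZS ω, T ω + ZT ω)) p μ ≤
        2 * eLpNorm (fun z : ℝ => z / τ) p (gaussianReal 0 τ)) →
      |∫ ω, k (S ω + ZS ω, T ω + ZT ω) * scoreResidual S ZS τ μ ω ∂μ| ≤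
        C * cov[S, T; μ] ^ (r / (4 + r) - ε) := by
  obtain ⟨L₁, hL₁⟩ := exists_lipschitzWith_polyGauss τ 1
  obtain ⟨L₂, hL₂⟩ := exists_lipschitzWith_polyGauss τ (polyGaussDeriv τ 1)
  -- the Hölder exponent of the tail is `θ = 1 - 1 / q`
  obtain ⟨q, hq, hθ, hεθ⟩ := exists_nnreal_one_sub_one_div_ge hε
  have hq_top : 2 * (q : ℝ≥0∞) ≠ ∞ := ENNReal.mul_ne_top ENNReal.ofNat_ne_top ENNReal.coe_ne_top
  obtain ⟨N, hN⟩ := WithTop.ne_top_iff_exists.1 (ENNReal.mul_ne_top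
    (ENNReal.ofNat_ne_top (n := 2)) (eLpNorm_div_gaussianReal_ne_top τ hq_top))
  have hq_two : 1 ≤ 2 * (q : ℝ≥0∞) :=
    one_le_two.trans (le_mul_of_one_le_right' (by exact_mod_cast hq))
  set C₁ := 8 * m * (max L₁ L₂ : ℝ≥0) ^ 2 * ((1 + √K) / τ + 1)
  set C₂ := N * N * (2 ^ (r + 1) * (A + ∫ z, |z| ^ r ∂gaussianReal 0 τ)) ^ (1 - 1 / (q : ℝ))
  refine ⟨(C₁ * K + C₂) / K ^ (r / (4 + r) - ε), fun Ω _ μ _ S T ZS ZT h hS hT k hk hkm hkN => ?_⟩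
  have hm : 0 ≤ m := by simpa using (abs_nonneg _).trans (hkm 0)
  have hA : 0 ≤ A := (integral_nonneg fun ω => by positivity).trans hS.2
  have hc := h.covariance_nonneg
  have hK : 0 ≤ K := hc.trans h.covariance_le
  have hcut : ∀ B, 1 ≤ B → |∫ ω, k (S ω + ZS ω, T ω + ZT ω) * scoreResidual S ZS τ μ ω ∂μ| ≤
      C₁ * K * B ^ 4 * (cov[S, T; μ] / K) + C₂ * B ^ (-(r * (1 - 1 / (q : ℝ)))) := fun B hB => by
    have hcov : K * (cov[S, T; μ] / K) = cov[S, T; μ] :=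
      mul_div_cancel_of_imp' fun hK0 => (h.covariance_le.trans_eq hK0).antisymm hc
    rw [mul_right_comm C₁, mul_assoc, hcov]
    exact h.abs_integral_mul_scoreResidual_le (hL₁.weaken (le_max_left _ _))
      (hL₂.weaken (le_max_right _ _)) hq hN.ge hk hkm ((hkN _ hq_two).trans hN.ge) hr hB hS hT
  refine (le_mul_rpow_of_forall_cutoff hr hθ hε.le hεθ (div_nonneg hc hK)
    (div_le_one_of_le₀ h.covariance_le hK) (by positivity) ?_ hcut).trans_eq ?_
  · have : 0 ≤ ∫ z : ℝ, |z| ^ r ∂gaussianReal 0 τ := integral_nonneg fun z => by positivity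
    positivity
  · rw [Real.div_rpow hc hK, mul_div_assoc', div_mul_eq_mul_div]

lemma mix_comm {Ω : Type*} (X Y : Ω → ℝ) (β : ℝ) : mix X Y β = mix Y X (1 - β) := by
  ext ω
  simp only [mix, sub_sub_cancel, add_comm]

namespace IsPQDPairWithNoise

variable {Ω : Type*} [MeasurableSpace Ω] {μ : Measure Ω} [IsProbabilityMeasure μ]
  {S T ZS ZT : Ω → ℝ} {K : ℝ} {τ : ℝ≥0} [NeZero τ] {β b : ℝ}

lemma abs_score_mix_sub_score_le (h : IsPQDPairWithNoise S T ZS ZT K τ μ)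
    (hβ : β ∈ Icc (0 : ℝ) 1) (hb : b ∈ Icc (0 : ℝ) 1) (p : ℝ × ℝ) :
    |score (mix (S + ZS) (T + ZT) β) μ (√β * p.1 + √(1 - β) * p.2) - b * score (T + ZT) μ p.2| ≤
      (3 + √(2 * K) + √K) / τ * (1 + ‖p‖) := by
  have hW : |score (mix (S + ZS) (T + ZT) β) μ (√β * p.1 + √(1 - β) * p.2)| ≤
      (2 * ‖p‖ + √(2 * K)) / τ := by
    rw [mix_add]
    refine ((h.isNoisy_mix hβ).abs_score_le _).trans ?_
    gcongr
    · calc |√β * p.1 + √(1 - β) * p.2| ≤ √β * |p.1| + √(1 - β) * |p.2| := by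
            simpa [abs_mul, abs_of_nonneg, Real.sqrt_nonneg] using
              abs_add_le (√β * p.1) (√(1 - β) * p.2)
        _ ≤ 1 * ‖p‖ + 1 * ‖p‖ := by
            gcongr
            · exact Real.sqrt_le_one.2 hβ.2
            · exact norm_fst_le p
            · exact Real.sqrt_le_one.2 (sub_le_self 1 hβ.1)
            · exact norm_snd_le p
        _ = 2 * ‖p‖ := by ring
    · exact h.integral_sq_mix_le hβ
  have hY : |b * score (T + ZT) μ p.2| ≤ (‖p‖ + √K) / τ := by
    rw [abs_mul, abs_of_nonneg hb.1]
    refine (mul_le_of_le_one_left (abs_nonneg _) hb.2).trans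
      ((h.symm.isNoisy_left.abs_score_le _).trans ?_)
    gcongr
    · exact norm_snd_le p
    · exact h.sq_T
  calc _ ≤ (2 * ‖p‖ + √(2 * K)) / τ + (‖p‖ + √K) / τ := (abs_sub _ _).trans (add_le_add hW hY)
    _ = (3 * ‖p‖ + (√(2 * K) + √K)) / τ := by ring
    _ ≤ (3 + √(2 * K) + √K) / τ * (1 + ‖p‖) := by
        rw [div_mul_eq_mul_div]
        gcongr
        nlinarith [norm_nonneg p, Real.sqrt_nonneg (2 * K), Real.sqrt_nonneg K]

lemma eLpNorm_score_mix_sub_score_le (h : IsPQDPairWithNoise S T ZS ZT K τ μ)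
    (hβ : β ∈ Icc (0 : ℝ) 1) (hb : b ∈ Icc (0 : ℝ) 1) {p : ℝ≥0∞} (hp : 1 ≤ p) :
    eLpNorm (fun ω => score (mix (S + ZS) (T + ZT) β) μ (mix (S + ZS) (T + ZT) β ω) -
        b * score (T + ZT) μ (T ω + ZT ω)) p μ ≤
      2 * eLpNorm (fun z : ℝ => z / τ) p (gaussianReal 0 τ) := by
  have hW := (h.isNoisy_mix hβ).eLpNorm_score_le hp
  have hY := h.symm.isNoisy_left.eLpNorm_score_le hp
  have hbY : eLpNorm (fun ω => b * score (T + ZT) μ (T ω + ZT ω)) p μ ≤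
      eLpNorm (fun ω => score (T + ZT) μ (T ω + ZT ω)) p μ :=
    eLpNorm_mono fun ω => by
      rw [norm_mul, Real.norm_of_nonneg hb.1]
      exact mul_le_of_le_one_left (norm_nonneg _) hb.2
  rw [two_mul, mix_add]
  exact (eLpNorm_sub_le (h.isNoisy_mix hβ).memLp_score.1
    (h.symm.isNoisy_left.memLp_score.1.const_mul b) hp).trans (add_le_add hW (hbY.trans hY))

end IsPQDPairWithNoise

lemma exists_forall_abs_integral_score_mul_scoreResidual_le (K A : ℝ) (τ : ℝ≥0) [NeZero τ]
    {r ε : ℝ} (hr : 0 < r) (hε : 0 < ε) :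
    ∃ C : ℝ, ∀ (Ω : Type u) [MeasurableSpace Ω] (μ : Measure Ω) [IsProbabilityMeasure μ]
      (S T ZS ZT : Ω → ℝ), IsPQDPairWithNoise S T ZS ZT K τ μ → AbsMomentLE S r A μ →
      AbsMomentLE T r A μ → ∀ β ∈ Icc (0 : ℝ) 1, ∀ b ∈ Icc (0 : ℝ) 1,
      |∫ ω, (score (mix (S + ZS) (T + ZT) β) μ (mix (S + ZS) (T + ZT) β ω) -
          b * score (T + ZT) μ (T ω + ZT ω)) * scoreResidual S ZS τ μ ω ∂μ| ≤
        C * cov[S, T; μ] ^ (r / (4 + r) - ε) := by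
  obtain ⟨C, hC⟩ := exists_forall_abs_integral_mul_scoreResidual_le.{u} K
    ((3 + √(2 * K) + √K) / τ) A τ hr hε
  refine ⟨C, fun Ω _ μ _ S T ZS ZT h hS hT β hβ b hb => hC Ω μ S T ZS ZT h hS hT
    (fun p => score (mix (S + ZS) (T + ZT) β) μ (√β * p.1 + √(1 - β) * p.2) -
      b * score (T + ZT) μ p.2) ?_ (h.abs_score_mix_sub_score_le hβ hb)
    fun p hp => h.eLpNorm_score_mix_sub_score_le hβ hb hp⟩
  have hW : Measurable (score (mix (S + ZS) (T + ZT) β) μ) :=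
    mix_add S T ZS ZT β ▸ (h.isNoisy_mix hβ).measurable_score
  have hY := h.symm.isNoisy_left.measurable_score
  fun_prop

lemma exists_forall_scoreGap_le (K A : ℝ) (τ : ℝ≥0) [NeZero τ] {r ε : ℝ} (hr : 0 < r)
    (hε : 0 < ε) :
    ∃ C : ℝ, ∀ (Ω : Type u) [MeasurableSpace Ω] (μ : Measure Ω) [IsProbabilityMeasure μ]
      (S T ZS ZT : Ω → ℝ), IsPQDPairWithNoise S T ZS ZT K τ μ → AbsMomentLE S r A μ →
      AbsMomentLE T r A μ → ∀ β ∈ Icc (0 : ℝ) 1,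
        scoreGap (S + ZS) (T + ZT) β μ ≤
          β * fisherInfo (S + ZS) μ + (1 - β) * fisherInfo (T + ZT) μ
            - fisherInfo (mix (S + ZS) (T + ZT) β) μ + C * cov[S, T; μ] ^ (r / (4 + r) - ε) := by
  obtain ⟨C, hC⟩ := exists_forall_abs_integral_score_mul_scoreResidual_le.{u} K A τ hr hε
  refine ⟨4 * C, fun Ω _ μ _ S T ZS ZT h hS hT β hβ => ?_⟩
  have hβ' : 1 - β ∈ Icc (0 : ℝ) 1 := ⟨sub_nonneg.2 hβ.2, sub_le_self 1 hβ.1⟩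
  have hX := hC Ω μ S T ZS ZT h hS hT β hβ (√(1 - β))
    ⟨Real.sqrt_nonneg _, Real.sqrt_le_one.2 hβ'.2⟩
  have hY := hC Ω μ T S ZT ZS h.symm hT hS (1 - β) hβ' 0 ⟨le_rfl, zero_le_one⟩
  simp only [zero_mul, sub_zero, ← mix_comm, covariance_comm T S] at hY
  rw [h.scoreGap_eq hβ]
  have hscale : ∀ {a x : ℝ}, a ∈ Icc (0 : ℝ) 1 → |x| ≤ C * cov[S, T; μ] ^ (r / (4 + r) - ε) →
      -(2 * √a * x) ≤ 2 * (C * cov[S, T; μ] ^ (r / (4 + r) - ε)) := fun {a x} ha hx => by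
    calc -(2 * √a * x) ≤ |2 * √a * x| := neg_le_abs _
      _ = 2 * (√a * |x|) := by rw [abs_mul, abs_of_nonneg (by positivity), mul_assoc]
      _ ≤ 2 * |x| := by
          gcongr
          exact mul_le_of_le_one_left (abs_nonneg x) (Real.sqrt_le_one.2 ha.2)
      _ ≤ _ := by gcongr
  linarith [hscale hβ hX, hscale hβ' hY]

end FKGFisher

end

theorem theorem2p2_general (K : ℝ) (τ : ℝ≥0) (hτ : 0 < τ) :
    (∀ (Ω : Type u) [MeasurableSpace Ω] (μ : Measure Ω) [IsProbabilityMeasure μ]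
      (S T ZS ZT : Ω → ℝ), FKGFisher.IsPQDPairWithNoise S T ZS ZT K τ μ →
      ∀ β ∈ Set.Icc (0 : ℝ) 1,
        FKGFisher.HasFiniteFisherInfo (S + ZS) μ ∧
        FKGFisher.HasFiniteFisherInfo (T + ZT) μ ∧
        FKGFisher.HasFiniteFisherInfo (FKGFisher.mix (S + ZS) (T + ZT) β) μ) ∧
    (∀ ε : ℝ, 0 < ε → ∃ C : ℝ,
      ∀ (Ω : Type u) [MeasurableSpace Ω] (μ : Measure Ω) [IsProbabilityMeasure μ]
        (S T ZS ZT : Ω → ℝ), FKGFisher.IsPQDPairWithNoise S T ZS ZT K τ μ →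
        ∀ β ∈ Set.Icc (0 : ℝ) 1,
          FKGFisher.scoreGap (S + ZS) (T + ZT) β μ ≤
            β * FKGFisher.fisherInfo (S + ZS) μ + (1 - β) * FKGFisher.fisherInfo (T + ZT) μ
              - FKGFisher.fisherInfo (FKGFisher.mix (S + ZS) (T + ZT) β) μ
              + C * cov[S, T; μ] ^ (1 / 3 - ε)) ∧
    (∀ ε δ L : ℝ, 0 < ε → 0 < δ → ∃ C : ℝ,
      ∀ (Ω : Type u) [MeasurableSpace Ω] (μ : Measure Ω) [IsProbabilityMeasure μ]
        (S T ZS ZT : Ω → ℝ), FKGFisher.IsPQDPairWithNoise S T ZS ZT K τ μ →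
        Integrable (fun ω => |S ω| ^ (2 + δ)) μ → ∫ ω, |S ω| ^ (2 + δ) ∂μ ≤ L →
        Integrable (fun ω => |T ω| ^ (2 + δ)) μ → ∫ ω, |T ω| ^ (2 + δ) ∂μ ≤ L →
        ∀ β ∈ Set.Icc (0 : ℝ) 1,
          FKGFisher.scoreGap (S + ZS) (T + ZT) β μ ≤
            β * FKGFisher.fisherInfo (S + ZS) μ + (1 - β) * FKGFisher.fisherInfo (T + ZT) μ
              - FKGFisher.fisherInfo (FKGFisher.mix (S + ZS) (T + ZT) β) μ
              + C * cov[S, T; μ] ^ ((2 + δ) / (6 + δ) - ε)) := by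
  have : NeZero τ := ⟨hτ.ne'⟩
  refine ⟨fun Ω _ μ _ S T ZS ZT h β hβ => h.hasFiniteFisherInfo hβ, fun ε hε => ?_,
    fun ε δ L hε hδ => ?_⟩
  · obtain ⟨C, hC⟩ := FKGFisher.exists_forall_scoreGap_le.{u} K K τ two_pos hε
    rw [show (2 : ℝ) / (4 + 2) = 1 / 3 by norm_num] at hC
    refine ⟨C, fun Ω _ μ _ S T ZS ZT h => hC Ω μ S T ZS ZT h ?_ ?_⟩ <;>
      simp only [FKGFisher.AbsMomentLE, Real.rpow_two, sq_abs]
    · exact ⟨h.memLp_S.integrable_sq, h.sq_S⟩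
    · exact ⟨h.memLp_T.integrable_sq, h.sq_T⟩
  · obtain ⟨C, hC⟩ := FKGFisher.exists_forall_scoreGap_le.{u} K L τ (add_pos two_pos hδ) hε
    rw [show 4 + (2 + δ) = 6 + δ by ring] at hC
    exact ⟨C, fun Ω _ μ _ S T ZS ZT h hSi hS hTi hT => hC Ω μ S T ZS ZT h ⟨hSi, hS⟩ ⟨hTi, hT⟩⟩

theorem theorem2p2 (K : ℝ) (τ : ℝ≥0) (hτ : 0 < τ) :
    -- all the quantities in the inequalities below are well defined and finite
    (∀ (Ω : Type u) [MeasurableSpace Ω] (μ : Measure Ω) [IsProbabilityMeasure μ]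
      (S T ZS ZT : Ω → ℝ), FKGFisher.IsFKGPairWithNoise S T ZS ZT K τ μ →
      ∀ β ∈ Set.Icc (0 : ℝ) 1,
        FKGFisher.HasFiniteFisherInfo (S + ZS) μ ∧
        FKGFisher.HasFiniteFisherInfo (T + ZT) μ ∧
        FKGFisher.HasFiniteFisherInfo (FKGFisher.mix (S + ZS) (T + ZT) β) μ) ∧
    -- almost sub-additivity of the Fisher information
    (∀ ε : ℝ, 0 < ε → ∃ C : ℝ,
      ∀ (Ω : Type u) [MeasurableSpace Ω] (μ : Measure Ω) [IsProbabilityMeasure μ]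
        (S T ZS ZT : Ω → ℝ), FKGFisher.IsFKGPairWithNoise S T ZS ZT K τ μ →
        ∀ β ∈ Set.Icc (0 : ℝ) 1,
          FKGFisher.scoreGap (S + ZS) (T + ZT) β μ ≤
            β * FKGFisher.fisherInfo (S + ZS) μ + (1 - β) * FKGFisher.fisherInfo (T + ZT) μ
              - FKGFisher.fisherInfo (FKGFisher.mix (S + ZS) (T + ZT) β) μ
              + C * cov[S, T; μ] ^ (1 / 3 - ε)) ∧
    -- the improved exponent if the moments of order `2 + δ` are at most `L`
    (∀ ε δ L : ℝ, 0 < ε → 0 < δ → ∃ C : ℝ,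
      ∀ (Ω : Type u) [MeasurableSpace Ω] (μ : Measure Ω) [IsProbabilityMeasure μ]
        (S T ZS ZT : Ω → ℝ), FKGFisher.IsFKGPairWithNoise S T ZS ZT K τ μ →
        Integrable (fun ω => |S ω| ^ (2 + δ)) μ → ∫ ω, |S ω| ^ (2 + δ) ∂μ ≤ L →
        Integrable (fun ω => |T ω| ^ (2 + δ)) μ → ∫ ω, |T ω| ^ (2 + δ) ∂μ ≤ L →
        ∀ β ∈ Set.Icc (0 : ℝ) 1,
          FKGFisher.scoreGap (S + ZS) (T + ZT) β μ ≤
            β * FKGFisher.fisherInfo (S + ZS) μ + (1 - β) * FKGFisher.fisherInfo (T + ZT) μ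
              - FKGFisher.fisherInfo (FKGFisher.mix (S + ZS) (T + ZT) β) μ
              + C * cov[S, T; μ] ^ ((2 + δ) / (6 + δ) - ε)) := by
  obtain ⟨hfin, hone, htwo⟩ := theorem2p2_general.{u} K τ hτ
  exact ⟨fun Ω _ μ _ S T ZS ZT h => hfin Ω μ S T ZS ZT h.isPQDPairWithNoise,
    fun ε hε => (hone ε hε).imp fun _ hC Ω _ μ _ S T ZS ZT h =>
      hC Ω μ S T ZS ZT h.isPQDPairWithNoise,
    fun ε δ L hε hδ => (htwo ε δ L hε hδ).imp fun _ hC Ω _ μ _ S T ZS ZT h =>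
      hC Ω μ S T ZS ZT h.isPQDPairWithNoise⟩
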